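/- **Model.** There are $n\ge 0$ actions and $m\ge 1$ outcomes $1,\dots,m$. Action $i$ has a cost $c_i\ge 0$ and leads to a random outcome $X_i$ with $\Pr[X_i=j]=p_{ij}$; the $X_i$ are independent. Outcome $j$ has a reward $r(j)$, where $0=r(1)\le\dots\le r(m)$. A contract is a map $t:[m]\to\mathbb{R}_{\ge 0}$. A strategy $\pi$ of the agent adaptively takes untaken actions one at a time, observing the outcome of each, and halts at some point; upon halting it selects as final outcome $\omega(\pi)$ one of the revealed outcomes, where outcome $1$ is always revealed. All its decisions may depend on the actions taken so far and on their outcomes. With $S(\pi)$ the set of actions taken, put $$u_A(t,\pi)=\mathbb{E}\Big[t(\omega(\pi))-\sum_{i\in S(\pi)}c_i\Big],\qquad u_P(t,\pi)=\mathbb{E}\big[r(\omega(\pi))-t(\omega(\pi))\big].$$ A strategy is optimal under $t$ if it maximizes $u_A(t,\cdot)$. A best response to $t$ is an optimal strategy under $t$ that maximizes $u_P(t,\cdot)$ among the optimal strategies under $t$. The principal's utility from $t$ is $u_P(t)=u_P(t,\pi)$ for a best response $\pi$ to $t$. A strategy is non-adaptive if it is given by an order $\sigma$ of the actions, a bijection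 $\rho:[m]\to[m]$ and thresholds $\tau_i\in[m]$: it takes the actions in the order $\sigma$, halts before action $i$ if the currently preferred revealed outcome $j$ (the one of largest $\rho$) satisfies $\rho(j)\ge\rho(\tau_i)$, and upon halting selects its preferred outcome. Let $t^\varepsilon(j)=t(j)+\varepsilon\,(r(j)-t(j))$. **Proposition.** 1. For every instance and every contract $t$ there is $\varepsilon_0>0$ such that for all $0<\varepsilon<\varepsilon_0$: $t^\varepsilon$ is a contract; every optimal strategy under $t^\varepsilon$ is a best response to $t$ (in particular its principal's utility under $t$ is $u_P(t)$); and some non-adaptive strategy is optimal under $t^\varepsilon$. 2. The principal's utility from a contract is computable in polynomial time. More precisely, there are one program for the real random access machine (unit-cost operations $+,-,\cdot,/$ and comparisons on reals; unit-cost addition, subtraction, comparison and indirect addressing on integers; no conversion between reals and integers) and constants $C,d$ such that, for every instance and every contract $t$, the program on input $(n,m,t,r,c,p)$ halts with output $u_P(t)$ after at most $C\,(nm^2+n\log n+1)$ steps, of which at most $C\,(nm^2+1)$ are arithmetic operations on reals; and if all input numbers are rational with at most $L$ bits each, then all real numbers that occur in the memory during the computation are rational with at most $C\,(n+m+L+1)^d$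 bits. -/

import Mathlib

namespace SeqContract

/-! ### The sequential contract model with independent actions -/

/-- An instance with `n` independent actions and `m ≥ 1` outcomes. Outcome `0 : Fin m` is the
zero outcome. Rewards are non-decreasing and start at `0` (so they are non-negative);
`prob i j` is the probability that action `i` leads to outcome `j`. -/
structure Setting (n m : ℕ) [NeZero m] where
  cost : Fin n → ℝ
  prob : Fin n → Fin m → ℝ
  reward : Fin m → ℝ
  cost_nonneg : ∀ i, 0 ≤ cost i
  prob_nonneg : ∀ i j, 0 ≤ prob i j
  prob_sum : ∀ i, ∑ j, prob i j = 1
  reward_mono : Monotone reward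
  reward_zero : reward 0 = 0

/-- A contract: a non-negative payment for each outcome. -/
def IsContract {m : ℕ} (t : Fin m → ℝ) : Prop := ∀ j, 0 ≤ t j

/-- An adaptive strategy as a decision tree: either halt and select the final outcome `j`,
or take action `i` and continue depending on the outcome that it reveals. -/
inductive Strategy (n m : ℕ) : Type
  | halt (j : Fin m) : Strategy n m
  | take (i : Fin n) (next : Fin m → Strategy n m) : Strategy n m

namespace Strategy

/-- The strategy can be followed after the actions in `S` have been taken and the outcomes in
`V` have been revealed: only untaken actions are taken, and the final outcome is a revealed
one. -/
def Valid {n m : ℕ} : Strategy n m → Finset (Fin n) → Finset (Fin m) → Prop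
  | halt j, _, V => j ∈ V
  | take i next, S, V => i ∉ S ∧ ∀ j, (next j).Valid (insert i S) (insert j V)

/-- A strategy of the agent: at the start no action is taken, and the zero outcome is always
revealed. -/
def Admissible {n m : ℕ} [NeZero m] (π : Strategy n m) : Prop := π.Valid ∅ {0}

/-- The set of actions taken when action `i` has the (hidden) outcome `x i`. -/
def taken {n m : ℕ} : Strategy n m → (Fin n → Fin m) → Finset (Fin n)
  | halt _, _ => ∅
  | take i next, x => insert i ((next (x i)).taken x)

/-- The final outcome when action `i` has the (hidden) outcome `x i`. -/
def final {n m : ℕ} : Strategy n m → (Fin n → Fin m) → Fin m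
  | halt j, _ => j
  | take i next, x => (next (x i)).final x

/-- The remaining part of a non-adaptive strategy: the list holds the actions still to be taken
in this order, `j` is the currently preferred outcome. Before action `i` the strategy halts if
`ρ (τ i) ≤ ρ j`. Upon halting it selects the preferred outcome. -/
def nonAdaptiveFrom {n m : ℕ} (ρ : Equiv.Perm (Fin m)) (τ : Fin n → Fin m) :
    List (Fin n) → Fin m → Strategy n m
  | [], j => halt j
  | i :: l, j =>
      if ρ (τ i) ≤ ρ j then halt j
      else take i fun k => nonAdaptiveFrom ρ τ l (if ρ j < ρ k then k else j)

/-- The non-adaptive strategy with order `σ` of the actions, preference `ρ` on the outcomes, and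
halting thresholds `τ`. -/
def nonAdaptive {n m : ℕ} [NeZero m] (σ : Equiv.Perm (Fin n)) (ρ : Equiv.Perm (Fin m))
    (τ : Fin n → Fin m) : Strategy n m :=
  nonAdaptiveFrom ρ τ (List.ofFn σ) 0

end Strategy

namespace Setting

/-- Expectation over the independent outcomes of all actions. -/
noncomputable def expect {n m : ℕ} [NeZero m] (I : Setting n m)
    (f : (Fin n → Fin m) → ℝ) : ℝ :=
  ∑ x : Fin n → Fin m, (∏ i, I.prob i (x i)) * f x

/-- The agent's utility: expected payment minus expected total cost of the actions taken. -/
noncomputable def agentUtility {n m : ℕ} [NeZero m] (I : Setting n m) (t : Fin m → ℝ)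
    (π : Strategy n m) : ℝ :=
  I.expect fun x => t (π.final x) - ∑ i ∈ π.taken x, I.cost i

/-- The principal's utility: expected reward minus expected payment. -/
noncomputable def principalUtility {n m : ℕ} [NeZero m] (I : Setting n m) (t : Fin m → ℝ)
    (π : Strategy n m) : ℝ :=
  I.expect fun x => I.reward (π.final x) - t (π.final x)

/-- The strategy maximizes the agent's utility. -/
def IsOptimal {n m : ℕ} [NeZero m] (I : Setting n m) (t : Fin m → ℝ)
    (π : Strategy n m) : Prop :=
  π.Admissible ∧ ∀ π' : Strategy n m, π'.Admissible → I.agentUtility t π' ≤ I.agentUtility t π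

/-- A best response of the agent: an optimal strategy, with ties broken in favor of the
principal. -/
def IsBestResponse {n m : ℕ} [NeZero m] (I : Setting n m) (t : Fin m → ℝ)
    (π : Strategy n m) : Prop :=
  I.IsOptimal t π ∧
    ∀ π' : Strategy n m, I.IsOptimal t π' → I.principalUtility t π' ≤ I.principalUtility t π

/-- `v` is the principal's utility from the contract `t` (all best responses give her the same
utility, so `v` is unique). -/
def IsPrincipalUtility {n m : ℕ} [NeZero m] (I : Setting n m) (t : Fin m → ℝ) (v : ℝ) : Prop :=
  ∃ π : Strategy n m, I.IsBestResponse t π ∧ I.principalUtility t π = v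

/-- The contract `t` perturbed towards the rewards. -/
def perturb {n m : ℕ} [NeZero m] (I : Setting n m) (t : Fin m → ℝ) (ε : ℝ) : Fin m → ℝ :=
  fun j => t j + ε * (I.reward j - t j)

end Setting

/-! ### A real random access machine -/

/-- The memory: integer registers, integer arrays, real registers and real arrays. Registers and
arrays are named by natural numbers; a program mentions finitely many of these names. -/
structure Memory where
  ireg : ℕ → ℕ
  iarr : ℕ → ℕ → ℕ
  rreg : ℕ → ℝ
  rarr : ℕ → ℕ → ℝ

/-- Arithmetic operations on real numbers (division by zero returns zero). -/
inductive Arith : Type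
  | add | sub | mul | div

noncomputable def Arith.eval : Arith → ℝ → ℝ → ℝ
  | add, x, y => x + y
  | sub, x, y => x - y
  | mul, x, y => x * y
  | div, x, y => x / y

/-- Basic instructions. Integers, which serve for addressing and counting, are only added and
subtracted (truncated at `0`); there is no conversion between reals and integers. -/
inductive Instr : Type
  /-- `ireg a := k` -/
  | iconst (a k : ℕ)
  /-- `ireg a := ireg b` -/
  | icopy (a b : ℕ)
  /-- `ireg a := ireg b + ireg c` -/
  | iadd (a b c : ℕ)
  /-- `ireg a := ireg b - ireg c` -/
  | isub (a b c : ℕ)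
  /-- `ireg a := iarr A [ireg b]` -/
  | iload (a A b : ℕ)
  /-- `iarr A [ireg b] := ireg a` -/
  | istore (A b a : ℕ)
  /-- `rreg a := k` -/
  | rconst (a : ℕ) (k : ℤ)
  /-- `rreg a := rreg b` -/
  | rcopy (a b : ℕ)
  /-- `rreg a := rreg b o rreg c` -/
  | rarith (o : Arith) (a b c : ℕ)
  /-- `rreg a := rarr A [ireg b]` -/
  | rload (a A b : ℕ)
  /-- `rarr A [ireg b] := rreg a` -/
  | rstore (A b a : ℕ)

noncomputable def Instr.exec : Instr → Memory → Memory
  | iconst a k, s => { s with ireg := Function.update s.ireg a k }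
  | icopy a b, s => { s with ireg := Function.update s.ireg a (s.ireg b) }
  | iadd a b c, s => { s with ireg := Function.update s.ireg a (s.ireg b + s.ireg c) }
  | isub a b c, s => { s with ireg := Function.update s.ireg a (s.ireg b - s.ireg c) }
  | iload a A b, s => { s with ireg := Function.update s.ireg a (s.iarr A (s.ireg b)) }
  | istore A b a, s =>
      { s with iarr := Function.update s.iarr A
                (Function.update (s.iarr A) (s.ireg b) (s.ireg a)) }
  | rconst a k, s => { s with rreg := Function.update s.rreg a (k : ℝ) }
  | rcopy a b, s => { s with rreg := Function.update s.rreg a (s.rreg b) }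
  | rarith o a b c, s =>
      { s with rreg := Function.update s.rreg a (o.eval (s.rreg b) (s.rreg c)) }
  | rload a A b, s => { s with rreg := Function.update s.rreg a (s.rarr A (s.ireg b)) }
  | rstore A b a, s =>
      { s with rarr := Function.update s.rarr A
                (Function.update (s.rarr A) (s.ireg b) (s.rreg a)) }

/-- Tests: `ireg a < ireg b` and `rreg a < rreg b`. -/
inductive Test : Type
  | ilt (a b : ℕ)
  | rlt (a b : ℕ)

def Test.Holds : Test → Memory → Prop
  | ilt a b, s => s.ireg a < s.ireg b
  | rlt a b, s => s.rreg a < s.rreg b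

/-- Programs. -/
inductive Prog : Type
  | skip
  | instr (i : Instr)
  | seq (P Q : Prog)
  | cond (b : Test) (P Q : Prog)
  | loop (b : Test) (P : Prog)

/-- A configuration: the program parts still to be executed, in this order, and the memory. -/
structure Conf where
  todo : List Prog
  mem : Memory

open Classical in
/-- One step of the computation: each basic instruction and each test costs one step. -/
noncomputable def Conf.step : Conf → Conf
  | ⟨[], s⟩ => ⟨[], s⟩
  | ⟨Prog.skip :: K, s⟩ => ⟨K, s⟩
  | ⟨Prog.instr i :: K, s⟩ => ⟨K, i.exec s⟩
  | ⟨Prog.seq P Q :: K, s⟩ => ⟨P :: Q :: K, s⟩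
  | ⟨Prog.cond b P Q :: K, s⟩ => if b.Holds s then ⟨P :: K, s⟩ else ⟨Q :: K, s⟩
  | ⟨Prog.loop b P :: K, s⟩ => if b.Holds s then ⟨P :: Prog.loop b P :: K, s⟩ else ⟨K, s⟩

/-- `1` if the next step is an arithmetic operation on real numbers, `0` otherwise. -/
def Conf.arithCost : Conf → ℕ
  | ⟨Prog.instr (Instr.rarith _ _ _ _) :: _, _⟩ => 1
  | _ => 0

/-- The configuration of program `P` after `k` steps from the initial memory `s`. -/
noncomputable def Prog.run (P : Prog) (s : Memory) (k : ℕ) : Conf := Conf.step^[k] ⟨[P], s⟩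

/-- The number of arithmetic operations on reals among the first `k` steps. -/
noncomputable def Prog.arithCount (P : Prog) (s : Memory) (k : ℕ) : ℕ :=
  ∑ l ∈ Finset.range k, (P.run s l).arithCost

/-- The initial memory for an instance and a contract: `n` and `m` are in the integer registers
`0` and `1`; the real arrays `0`, `1`, `2`, `3` hold the payments, the rewards, the costs and
the probabilities (row by row: `prob i j` has the index `i * m + j`). All else is `0`. -/
noncomputable def inputMemory {n m : ℕ} [NeZero m] (I : Setting n m) (t : Fin m → ℝ) :
    Memory where
  ireg a := if a = 0 then n else if a = 1 then m else 0
  iarr _ _ := 0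
  rreg _ := 0
  rarr A k :=
    if A = 0 then (if h : k < m then t ⟨k, h⟩ else 0)
    else if A = 1 then (if h : k < m then I.reward ⟨k, h⟩ else 0)
    else if A = 2 then (if h : k < n then I.cost ⟨k, h⟩ else 0)
    else if A = 3 then
      (if h : k / m < n then I.prob ⟨k / m, h⟩ ⟨k % m, Nat.mod_lt k (NeZero.pos m)⟩ else 0)
    else 0

/-! ### Bit sizes -/

/-- `x` is a rational number whose reduced fraction is written with at most `B` bits. -/
def HasBitSize (x : ℝ) (B : ℕ) : Prop :=
  ∃ q : ℚ, (q : ℝ) = x ∧ q.num.natAbs.size + q.den.size ≤ B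

/-- All numbers of the instance and of the contract are rational with at most `L` bits. -/
def InputBitSize {n m : ℕ} [NeZero m] (I : Setting n m) (t : Fin m → ℝ) (L : ℕ) : Prop :=
  (∀ j, HasBitSize (t j) L ∧ HasBitSize (I.reward j) L) ∧
    ∀ i, HasBitSize (I.cost i) L ∧ ∀ j, HasBitSize (I.prob i j) L

/-- All real numbers in the memory are rational with at most `B` bits. (An integer register
grows by at most one bit per addition, so the integers need no bound of their own.) -/
def MemoryBitSize (s : Memory) (B : ℕ) : Prop :=
  (∀ a, HasBitSize (s.rreg a) B) ∧ ∀ A k, HasBitSize (s.rarr A k) B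

end SeqContract

/-! Under a contract `v` the agent faces Pandora's box problem: opening box `i` costs `c_i`, and one
revealed payoff is kept. Let the reservation value `z_i` solve `∑ a, p_ia (v_a - z_i)⁺ = c_i`.
Whether action `i` is taken does not depend on its own outcome, so in expectation `c_i` may be
replaced by the excess `(v(x_i) - z_i)⁺` (`agentUtility_eq_of_isReservation`). Then every strategy
earns, for each realization `x`, at most the maximum of `v_0` and all capped values `min (v(x_i))
z_i`. Taking actions by decreasing `z_i`, and halting once the best payoff reaches the next `z_i`,
attains this bound (`index_payoff`, `isOptimal_index`).

Ties: the agent's utility under the perturbed contract is `u_A + ε u_P`. There are finitely many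
admissible strategies, so for small `ε` its maximizers maximize `(u_A, u_P)` lexicographically and
are best responses (`eventually_isBestResponse`).

The program treats `ε` symbolically: payoffs and reservation values are pairs compared
lexicographically. A reservation value is the largest quotient of (upper partial sum of `p v`, minus
cost) by (upper mass) over all thresholds (`isReservation_of_max`). Only finitely many pairs are
compared, so these comparisons agree with those for one small real `ε`, and the symbolic run follows
an optimal index strategy of the perturbed contract (`isPrincipalUtility_value`). The principal's
expected gain comes from a backward recursion over the best outcome so far, with `O(m²)` operations
per action. A tournament tree supplies the actions by increasing reservation value with `O(log n)`
work each and no arithmetic on reals.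

Steps, arithmetic operations and a predicate on all occurring reals are tracked together by the
program logic `Spec`. For the bit sizes, all inputs get a common denominator `Q`; each action
multiplies the denominator of the values by at most one more `Q`, while their magnitude does not
grow because probabilities sum to one (`isFraction_value`). -/

namespace SeqContract

/-! ### A program logic with resource bounds for the real random access machine -/

/-- All reals in the memory satisfy `G`. -/
def Memory.All (G : ℝ → Prop) (s : Memory) : Prop :=
  (∀ a, G (s.rreg a)) ∧ ∀ A k, G (s.rarr A k)

namespace Instr

/-- Which integer registers, integer arrays, real registers and real arrays are written. -/
def writesIreg (x : ℕ) : Instr → Bool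
  | iconst a _ | icopy a _ | iadd a _ _ | isub a _ _ | iload a _ _ => a == x
  | _ => false

def writesIarr (x : ℕ) : Instr → Bool
  | istore A _ _ => A == x
  | _ => false

def writesRreg (x : ℕ) : Instr → Bool
  | rconst a _ | rcopy a _ | rarith _ a _ _ | rload a _ _ => a == x
  | _ => false

def writesRarr (x : ℕ) : Instr → Bool
  | rstore A _ _ => A == x
  | _ => false

/-- The real number that the instruction creates satisfies `G`. -/
def Creates (G : ℝ → Prop) (s : Memory) : Instr → Prop
  | rconst _ k => G k
  | rarith o _ b c => G (o.eval (s.rreg b) (s.rreg c))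
  | _ => True

def arithCost : Instr → ℕ
  | rarith _ _ _ _ => 1
  | _ => 0

theorem all_exec {G : ℝ → Prop} {s : Memory} (h : s.All G) (i : Instr) (hi : i.Creates G s) :
    (i.exec s).All G := by
  obtain ⟨h1, h2⟩ := h
  cases i <;> refine ⟨fun x => ?_, fun A k => ?_⟩ <;>
    simp only [exec, Function.update_apply] <;> (try split_ifs) <;>
    first
      | exact h1 _
      | exact h2 _ _
      | exact hi
      | (simp only [Function.update_apply]; split_ifs <;> first | exact h1 _ | exact h2 _ _)

end Instr

namespace Prog

/-- Some instruction of the program has the property `f`. -/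
def any (f : Instr → Bool) : Prog → Bool
  | skip => false
  | instr i => f i
  | seq P Q => P.any f || Q.any f
  | cond _ P Q => P.any f || Q.any f
  | loop _ P => P.any f

/-- Sequential composition of a list of programs. -/
def block : List Prog → Prog
  | [] => skip
  | P :: l => seq P (block l)

/-- Bound on the number of steps of a loop-free program. -/
def cost : Prog → ℕ
  | skip => 1
  | instr _ => 1
  | seq P Q => P.cost + Q.cost + 1
  | cond _ P Q => max P.cost Q.cost + 1
  -- A dummy value: loops are excluded where `cost` is used, since their `wp` is `False`.
  | loop _ _ => 0

/-- Bound on the number of arithmetic operations of a loop-free program. -/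
def ariths : Prog → ℕ
  | skip => 0
  | instr i => i.arithCost
  | seq P Q => P.ariths + Q.ariths
  | cond _ P Q => max P.ariths Q.ariths
  | loop _ _ => 0

end Prog

/-- The memories agree on everything that the program does not write. -/
structure Unchanged (P : Prog) (s s' : Memory) : Prop where
  ireg : ∀ a, P.any (Instr.writesIreg a) = false → s'.ireg a = s.ireg a
  iarr : ∀ a, P.any (Instr.writesIarr a) = false → s'.iarr a = s.iarr a
  rreg : ∀ a, P.any (Instr.writesRreg a) = false → s'.rreg a = s.rreg a
  rarr : ∀ a, P.any (Instr.writesRarr a) = false → s'.rarr a = s.rarr a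

namespace Unchanged

theorem refl (P : Prog) (s : Memory) : Unchanged P s s :=
  ⟨fun _ _ => rfl, fun _ _ => rfl, fun _ _ => rfl, fun _ _ => rfl⟩

theorem trans {P : Prog} {s s' s'' : Memory} (h : Unchanged P s s') (h' : Unchanged P s' s'') :
    Unchanged P s s'' :=
  ⟨fun a ha => (h'.ireg a ha).trans (h.ireg a ha), fun a ha => (h'.iarr a ha).trans (h.iarr a ha),
    fun a ha => (h'.rreg a ha).trans (h.rreg a ha), fun a ha => (h'.rarr a ha).trans (h.rarr a ha)⟩

theorem mono {P P' : Prog} {s s' : Memory} (h : Unchanged P s s')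
    (hP : ∀ f, P'.any f = false → P.any f = false) : Unchanged P' s s' :=
  ⟨fun a ha => h.ireg a (hP _ ha), fun a ha => h.iarr a (hP _ ha),
    fun a ha => h.rreg a (hP _ ha), fun a ha => h.rarr a (hP _ ha)⟩

theorem exec (i : Instr) (s : Memory) : Unchanged (Prog.instr i) s (i.exec s) := by
  constructor <;> intro a ha <;> cases i <;>
    first
      | rfl
      | exact Function.update_of_ne (fun h => by
          simp [Prog.any, Instr.writesIreg, Instr.writesIarr, Instr.writesRreg,
            Instr.writesRarr, h] at ha) _ _

end Unchanged

/-- The configuration `c'` is reached from `c` in `T` steps with `A` arithmetic operations, and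
all reals in the memory satisfy `G` on the way. -/
structure Reach (G : ℝ → Prop) (c c' : Conf) (T A : ℕ) : Prop where
  iter : Conf.step^[T] c = c'
  count : ∑ l ∈ Finset.range T, (Conf.step^[l] c).arithCost = A
  all : ∀ l ≤ T, (Conf.step^[l] c).mem.All G

namespace Reach

variable {G : ℝ → Prop} {c c' c'' : Conf} {T T' A A' : ℕ}

theorem one (hc : c.mem.All G) (hc' : c.step.mem.All G) :
    Reach G c c.step 1 c.arithCost := by
  refine ⟨rfl, by simp, fun l hl => ?_⟩
  interval_cases l
  · exact hc
  · exact hc'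

theorem trans (h : Reach G c c' T A) (h' : Reach G c' c'' T' A') :
    Reach G c c'' (T + T') (A + A') := by
  have key : ∀ l, Conf.step^[T + l] c = Conf.step^[l] c' := fun l => by
    rw [add_comm, Function.iterate_add_apply, h.iter]
  refine ⟨by rw [key, h'.iter], ?_, fun l hl => ?_⟩
  · rw [Finset.sum_range_add, h.count]
    simp only [key, h'.count]
  · rcases le_total l T with hlT | hlT
    · exact h.all l hlT
    · obtain ⟨k, rfl⟩ := Nat.exists_eq_add_of_le hlT
      rw [key]
      exact h'.all k (by omega)

end Reach

/-- Started in `s` (with reals in `G`), the program halts within `T` steps, of which at most `A`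
are arithmetic, in a memory with `Q`; all reals on the way satisfy `G`. -/
def Spec (G : ℝ → Prop) (P : Prog) (T A : ℕ) (s : Memory) (Q : Memory → Prop) : Prop :=
  s.All G → ∃ s' T' A', T' ≤ T ∧ A' ≤ A ∧ Unchanged P s s' ∧ Q s' ∧ s'.All G ∧
    ∀ K, Reach G ⟨P :: K, s⟩ ⟨K, s'⟩ T' A'

namespace Spec

variable {G : ℝ → Prop} {P P' : Prog} {b : Test} {s : Memory} {Q Q' R : Memory → Prop}
  {T T' T₁ T₂ A A' A₁ A₂ : ℕ}

theorem conseq (h : Spec G P T A s Q) (hQ : ∀ s', Unchanged P s s' → Q s' → Q' s')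
    (hT : T ≤ T') (hA : A ≤ A') : Spec G P T' A' s Q' := fun hs => by
  obtain ⟨s', t, a, ht, ha, hu, hq, hs', hr⟩ := h hs
  exact ⟨s', t, a, ht.trans hT, ha.trans hA, hu, hQ s' hu hq, hs', hr⟩

theorem skip (h : Q s) : Spec G Prog.skip 1 0 s Q := fun hs =>
  ⟨s, 1, 0, le_rfl, le_rfl, Unchanged.refl _ _, h, hs, fun K =>
    Reach.one (c := ⟨Prog.skip :: K, s⟩) hs hs⟩

theorem instr {i : Instr} (hi : i.Creates G s) (h : Q (i.exec s)) :
    Spec G (Prog.instr i) 1 i.arithCost s Q := fun hs => by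
  have hs' := Instr.all_exec hs i hi
  refine ⟨_, 1, i.arithCost, le_rfl, le_rfl, Unchanged.exec i s, h, hs', fun K => ?_⟩
  have := Reach.one (G := G) (c := ⟨Prog.instr i :: K, s⟩) hs hs'
  cases i <;> exact this

theorem seq (h : Spec G P T₁ A₁ s R)
    (h' : ∀ s', Unchanged P s s' → R s' → Spec G P' T₂ A₂ s' Q)
    (hT : T₁ + T₂ + 1 ≤ T) (hA : A₁ + A₂ ≤ A) : Spec G (Prog.seq P P') T A s Q := fun hs => by
  obtain ⟨s₁, t₁, a₁, ht₁, ha₁, hu₁, hq₁, hs₁, hr₁⟩ := h hs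
  obtain ⟨s₂, t₂, a₂, ht₂, ha₂, hu₂, hq₂, hs₂, hr₂⟩ := h' s₁ hu₁ hq₁ hs₁
  refine ⟨s₂, 1 + t₁ + t₂, 0 + a₁ + a₂, by omega, by omega,
    (hu₁.mono ?_).trans (hu₂.mono ?_), hq₂, hs₂, fun K => ?_⟩
  · intro f hf
    simp_all [Prog.any]
  · intro f hf
    simp_all [Prog.any]
  · exact ((Reach.one (c := ⟨Prog.seq P P' :: K, s⟩) hs hs).trans (hr₁ _)).trans (hr₂ _)

theorem cond (h : b.Holds s → Spec G P T A s Q) (h' : ¬ b.Holds s → Spec G P' T A s Q) :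
    Spec G (Prog.cond b P P') (T + 1) A s Q := fun hs => by
  by_cases hb : b.Holds s
  · obtain ⟨s', t, a, ht, ha, hu, hq, hs', hr⟩ := h hb hs
    refine ⟨s', 1 + t, 0 + a, by omega, by omega, hu.mono ?_, hq, hs', fun K => ?_⟩
    · intro f hf
      simp_all [Prog.any]
    · have hstep : Conf.step ⟨Prog.cond b P P' :: K, s⟩ = ⟨P :: K, s⟩ := by
        simp [Conf.step, hb]
      have := Reach.one (G := G) (c := ⟨Prog.cond b P P' :: K, s⟩) hs (by rw [hstep]; exact hs)
      rw [hstep] at this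
      exact this.trans (hr K)
  · obtain ⟨s', t, a, ht, ha, hu, hq, hs', hr⟩ := h' hb hs
    refine ⟨s', 1 + t, 0 + a, by omega, by omega, hu.mono ?_, hq, hs', fun K => ?_⟩
    · intro f hf
      simp_all [Prog.any]
    · have hstep : Conf.step ⟨Prog.cond b P P' :: K, s⟩ = ⟨P' :: K, s⟩ := by
        simp [Conf.step, hb]
      have := Reach.one (G := G) (c := ⟨Prog.cond b P P' :: K, s⟩) hs (by rw [hstep]; exact hs)
      rw [hstep] at this
      exact this.trans (hr K)

/-- A loop that runs exactly `N` times, with invariant `Inv k` after `k` rounds. -/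
theorem loop (N : ℕ) (Inv : ℕ → Memory → Prop) (h0 : Inv 0 s)
    (hstep : ∀ k < N, ∀ s', Unchanged P s s' → Inv k s' →
      b.Holds s' ∧ Spec G P T A s' (Inv (k + 1)))
    (hend : ∀ s', Unchanged P s s' → Inv N s' → ¬ b.Holds s') :
    Spec G (Prog.loop b P) (N * (T + 1) + 1) (N * A) s (Inv N) := fun hs => by
  have hmono : ∀ {x y : Memory}, Unchanged P x y → Unchanged (Prog.loop b P) x y :=
    fun h => h.mono fun f hf => by simpa [Prog.any] using hf
  -- The loop head after `k` rounds. A round costs one test besides the body, and the final failing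
  -- test accounts for the last `+ 1`.
  have key : ∀ k ≤ N, ∃ s' T' A', T' ≤ k * (T + 1) ∧ A' ≤ k * A ∧ Unchanged P s s' ∧ Inv k s' ∧
      s'.All G ∧ ∀ K, Reach G ⟨Prog.loop b P :: K, s⟩ ⟨Prog.loop b P :: K, s'⟩ T' A' := by
    intro k
    induction k with
    | zero =>
      exact fun _ => ⟨s, 0, 0, by simp, by simp, Unchanged.refl _ _, h0, hs, fun K =>
        ⟨rfl, by simp, fun l hl => by obtain rfl : l = 0 := by omega
                                      exact hs⟩⟩
    | succ k ih =>
      intro hk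
      obtain ⟨s₁, t₁, a₁, ht₁, ha₁, hu₁, hq₁, hs₁, hr₁⟩ := ih (by omega)
      obtain ⟨hb, hspec⟩ := hstep k (by omega) s₁ hu₁ hq₁
      obtain ⟨s₂, t₂, a₂, ht₂, ha₂, hu₂, hq₂, hs₂, hr₂⟩ := hspec hs₁
      refine ⟨s₂, t₁ + (1 + t₂), a₁ + (0 + a₂), by rw [Nat.succ_mul]; omega,
        by rw [Nat.succ_mul]; omega, hu₁.trans hu₂, hq₂, hs₂, fun K => ?_⟩
      have hst : Conf.step ⟨Prog.loop b P :: K, s₁⟩ = ⟨P :: Prog.loop b P :: K, s₁⟩ := by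
        simp [Conf.step, hb]
      have := Reach.one (G := G) (c := ⟨Prog.loop b P :: K, s₁⟩) hs₁ (by rw [hst]; exact hs₁)
      rw [hst] at this
      exact (hr₁ K).trans (this.trans (hr₂ _))
  obtain ⟨s', t, a, ht, ha, hu, hq, hs', hr⟩ := key N le_rfl
  refine ⟨s', t + 1, a + 0, by omega, by omega, hmono hu, hq, hs', fun K => ?_⟩
  have hst : Conf.step ⟨Prog.loop b P :: K, s'⟩ = ⟨K, s'⟩ := by
    simp [Conf.step, hend s' hu hq]
  have := Reach.one (G := G) (c := ⟨Prog.loop b P :: K, s'⟩) hs' (by rw [hst]; exact hs')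
  rw [hst] at this
  exact (hr K).trans this

/-- The run of a complete program. -/
theorem run (h : Spec G P T A s Q) (hs : s.All G) :
    ∃ k ≤ T, (P.run s k).todo = [] ∧ Q (P.run s k).mem ∧ P.arithCount s k ≤ A ∧
      ∀ l, (P.run s l).mem.All G := by
  obtain ⟨s', k, a, hk, ha, -, hq, hs', hr⟩ := h hs
  have hr := hr []
  have hrun : P.run s k = ⟨[], s'⟩ := hr.iter
  refine ⟨k, hk, by rw [hrun], by rw [hrun]; exact hq, ?_, fun l => ?_⟩
  · exact (le_of_eq hr.count).trans ha
  · rcases le_total l k with hl | hl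
    · exact hr.all l hl
    -- A halted configuration is a fixed point of `Conf.step`, so the predicate on the reals holds
    -- at all later times too.
    · obtain ⟨j, rfl⟩ := Nat.exists_eq_add_of_le hl
      have : Conf.step^[k + j] ⟨[P], s⟩ = ⟨[], s'⟩ := by
        rw [add_comm, Function.iterate_add_apply, hr.iter]
        exact Function.iterate_fixed rfl j
      rw [Prog.run, this]
      exact hs'

end Spec

/-- Weakest precondition of a loop-free program. -/
def Prog.wp (G : ℝ → Prop) : Prog → (Memory → Prop) → Memory → Prop
  | skip, Q, s => Q s
  | instr i, Q, s => i.Creates G s ∧ Q (i.exec s)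
  | seq P P', Q, s => P.wp G (P'.wp G Q) s
  | cond b P P', Q, s => (b.Holds s → P.wp G Q s) ∧ (¬ b.Holds s → P'.wp G Q s)
  | loop _ _, _, _ => False

theorem Spec.of_wp {G : ℝ → Prop} {P : Prog} {s : Memory} {Q : Memory → Prop}
    (h : P.wp G Q s) : Spec G P P.cost P.ariths s Q := by
  induction P generalizing s Q with
  | skip => exact Spec.skip h
  | instr i => exact Spec.instr h.1 h.2
  | seq P P' ih ih' => exact Spec.seq (ih h) (fun s' _ h' => ih' h') le_rfl le_rfl
  | cond b P P' ih ih' =>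
    exact Spec.cond
      (fun hb => (ih (h.1 hb)).conseq (fun _ _ h => h) (le_max_left _ _) (le_max_left _ _))
      (fun hb => (ih' (h.2 hb)).conseq (fun _ _ h => h) (le_max_right _ _) (le_max_right _ _))
  | loop b P => exact h.elim

/-! ### Expectations -/

namespace Setting

variable {n m : ℕ} [NeZero m] (I : Setting n m)

theorem weight_nonneg (x : Fin n → Fin m) : 0 ≤ ∏ i, I.prob i (x i) :=
  Finset.prod_nonneg fun i _ => I.prob_nonneg i _

theorem expect_mono {f g : (Fin n → Fin m) → ℝ} (h : ∀ x, f x ≤ g x) : I.expect f ≤ I.expect g :=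
  Finset.sum_le_sum fun x _ => mul_le_mul_of_nonneg_left (h x) (I.weight_nonneg x)

theorem expect_add (f g : (Fin n → Fin m) → ℝ) :
    I.expect (fun x => f x + g x) = I.expect f + I.expect g := by
  simp only [expect, mul_add, Finset.sum_add_distrib]

theorem expect_sub (f g : (Fin n → Fin m) → ℝ) :
    I.expect (fun x => f x - g x) = I.expect f - I.expect g := by
  simp only [expect, mul_sub, Finset.sum_sub_distrib]

theorem expect_mul (c : ℝ) (f : (Fin n → Fin m) → ℝ) :
    I.expect (fun x => c * f x) = c * I.expect f := by
  simp only [expect, Finset.mul_sum]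
  exact Finset.sum_congr rfl fun x _ => by ring

theorem expect_sum {ι : Type*} (s : Finset ι) (f : ι → (Fin n → Fin m) → ℝ) :
    I.expect (fun x => ∑ i ∈ s, f i x) = ∑ i ∈ s, I.expect (f i) := by
  simp only [expect, Finset.mul_sum]
  exact Finset.sum_comm

theorem expect_const (c : ℝ) : I.expect (fun _ => c) = c := by
  have h : ∑ x : Fin n → Fin m, ∏ i, I.prob i (x i) = 1 := by
    rw [← Fintype.prod_sum]
    simp [I.prob_sum]
  rw [expect, ← Finset.sum_mul, h, one_mul]

/-- The outcome of action `i` can be drawn separately. -/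
theorem expect_eq_sum_update (i : Fin n) (f : (Fin n → Fin m) → ℝ) :
    I.expect f = ∑ a, I.prob i a * I.expect fun x => f (Function.update x i a) := by
  classical
  set e := Equiv.funSplitAt i (Fin m)
  have hw : ∀ b y, ∏ k, I.prob k (e.symm (b, y) k) =
      I.prob i b * ∏ k : {k // k ≠ i}, I.prob k (y k) := by
    intro b y
    rw [Fintype.prod_eq_mul_prod_subtype_ne _ i]
    congr 1
    · simp [e, Equiv.funSplitAt, Equiv.piSplitAt]
    · refine Finset.prod_congr rfl fun k _ => ?_
      simp [e, Equiv.funSplitAt, Equiv.piSplitAt, k.2]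
  have hu : ∀ a b y, Function.update (e.symm (b, y)) i a = e.symm (a, y) := by
    intro a b y
    ext k
    by_cases hk : k = i
    · subst hk
      simp [e, Equiv.funSplitAt, Equiv.piSplitAt]
    · simp [e, Equiv.funSplitAt, Equiv.piSplitAt, hk]
  have hs : ∀ g : (Fin n → Fin m) → ℝ, I.expect g =
      ∑ b, I.prob i b * ∑ y, (∏ k : {k // k ≠ i}, I.prob k (y k)) * g (e.symm (b, y)) := by
    intro g
    rw [expect, ← e.symm.sum_comp, Fintype.sum_prod_type]
    refine Finset.sum_congr rfl fun b _ => ?_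
    rw [Finset.mul_sum]
    refine Finset.sum_congr rfl fun y _ => ?_
    rw [hw, mul_assoc]
  rw [hs f]
  refine Finset.sum_congr rfl fun a _ => ?_
  rw [hs]
  simp only [hu]
  -- In the inner expectation coordinate `i` is overwritten, so its own weights just sum to one.
  rw [← Finset.sum_mul, I.prob_sum, one_mul]

end Setting

/-! ### Admissible strategies -/

namespace Strategy

variable {n m : ℕ}

/-- No action repeats along a branch, so the number of untaken actions bounds the depth of the tree;
this number drives the induction. Finiteness is what allows one `ε` to serve all strategies at once.
-/
theorem finite_valid (S : Finset (Fin n)) (V : Finset (Fin m)) :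
    {π : Strategy n m | π.Valid S V}.Finite := by
  induction hk : (Finset.univ \ S).card using Nat.strong_induction_on generalizing S V with
  | _ k ih =>
    have hsub : {π : Strategy n m | π.Valid S V} ⊆ Set.range halt ∪
        ⋃ i ∈ {i : Fin n | i ∉ S}, take i ''
          {f | ∀ j, f j ∈ {π : Strategy n m | π.Valid (insert i S) (insert j V)}} := by
      intro π hπ
      cases π with
      | halt j => exact Or.inl ⟨j, rfl⟩
      | take i next =>
        refine Or.inr (Set.mem_biUnion (x := i) hπ.1 ⟨next, hπ.2, rfl⟩)
    refine Set.Finite.subset ((Set.finite_range _).union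
      (Set.Finite.biUnion (Set.toFinite _) fun i hi => Set.Finite.image _ ?_)) hsub
    refine Set.Finite.subset (Set.Finite.pi' fun j => ih _ ?_ (insert i S) (insert j V) rfl)
      fun f hf => hf
    rw [← hk]
    refine Finset.card_lt_card ⟨Finset.sdiff_subset_sdiff le_rfl (Finset.subset_insert _ _), ?_⟩
    intro h
    have : i ∈ Finset.univ \ insert i S := h (by simpa using hi)
    simp at this

theorem finite_admissible [NeZero m] : {π : Strategy n m | π.Admissible}.Finite :=
  finite_valid ∅ {0}

/-- The outcome of `i` is read only after `i` has been taken. This independence is the probabilistic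
core of replacing costs by excesses. -/
theorem mem_taken_update (π : Strategy n m) (i : Fin n) (a : Fin m) (x : Fin n → Fin m) :
    i ∈ π.taken (Function.update x i a) ↔ i ∈ π.taken x := by
  induction π with
  | halt j => simp [taken]
  | take k next ih =>
    by_cases hk : i = k
    · simp [taken, hk]
    · simp [taken, hk, Ne.symm hk, Function.update_of_ne, ih]

theorem final_mem {π : Strategy n m} {S : Finset (Fin n)} {V : Finset (Fin m)}
    (h : π.Valid S V) (x : Fin n → Fin m) :
    π.final x ∈ V ∨ ∃ i ∈ π.taken x, π.final x = x i := by
  induction π generalizing S V with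
  | halt j => exact Or.inl h
  | take i next ih =>
    rcases ih (x i) (h.2 (x i)) with h' | ⟨k, hk, hk'⟩
    · rcases Finset.mem_insert.1 h' with h' | h'
      · exact Or.inr ⟨i, by simp [taken], h'⟩
      · exact Or.inl h'
    · exact Or.inr ⟨k, by simp [taken, hk], hk'⟩

end Strategy

/-! ### Perturbed contracts -/

/-- For finitely many pairs, the lexicographic order is the order of `x + ε y` for small `ε`. -/
theorem eventually_lex_lt_iff {F : Set (ℝ ×ₗ ℝ)} (hF : F.Finite) :
    ∀ᶠ ε : ℝ in nhdsWithin 0 (Set.Ioi 0), ∀ x ∈ F, ∀ y ∈ F,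
      (x < y ↔ (ofLex x).1 + ε * (ofLex x).2 < (ofLex y).1 + ε * (ofLex y).2) := by
  have key : ∀ x y : ℝ ×ₗ ℝ, x < y → ∀ᶠ ε : ℝ in nhdsWithin 0 (Set.Ioi 0),
      (ofLex x).1 + ε * (ofLex x).2 < (ofLex y).1 + ε * (ofLex y).2 := by
    intro x y hxy
    rcases Prod.Lex.lt_iff.1 hxy with h | ⟨h1, h2⟩
    -- Different first coordinates stay ordered near `ε = 0` by continuity; equal ones leave the
    -- decision to `ε > 0`.
    · apply nhdsWithin_le_nhds
      have hc : ContinuousAt (fun ε : ℝ => ((ofLex y).1 + ε * (ofLex y).2) -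
          ((ofLex x).1 + ε * (ofLex x).2)) 0 := by fun_prop
      have := hc.eventually (lt_mem_nhds (a := 0) (by simpa using h))
      filter_upwards [this] with ε hε
      linarith
    · filter_upwards [self_mem_nhdsWithin] with ε hε
      have hε : (0 : ℝ) < ε := hε
      rw [h1]
      nlinarith
  rw [Filter.eventually_all_finite hF]
  intro x _
  rw [Filter.eventually_all_finite hF]
  intro y _
  rcases lt_trichotomy x y with h | h | h
  · filter_upwards [key x y h] with ε hε
    simp [h, hε]
  · subst h
    simp
  · filter_upwards [key y x h] with ε hε
    simp [h.le, hε.le, not_lt.2]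

namespace Setting

variable {n m : ℕ} [NeZero m] (I : Setting n m)

/-- Linearity of expectation; the costs are not perturbed. A small `ε` thus breaks the agent's ties
in the principal's favor. -/
theorem agentUtility_perturb (t : Fin m → ℝ) (ε : ℝ) (π : Strategy n m) :
    I.agentUtility (I.perturb t ε) π = I.agentUtility t π + ε * I.principalUtility t π := by
  rw [agentUtility, agentUtility, principalUtility, ← expect_mul, ← expect_add]
  congr 1
  funext x
  simp only [perturb]
  ring

/-- The perturbed contract is the convex combination `(1 - ε) t + ε r` of non-negative vectors. -/
theorem isContract_perturb {t : Fin m → ℝ} (ht : IsContract t) {ε : ℝ} (h0 : 0 ≤ ε) (h1 : ε ≤ 1) :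
    IsContract (I.perturb t ε) := fun j => by
  have hr : 0 ≤ I.reward j := I.reward_zero ▸ I.reward_mono (Fin.zero_le j)
  have := ht j
  simp only [perturb]
  nlinarith [mul_nonneg h0 hr, mul_nonneg (sub_nonneg.2 h1) this]

/-- A best response is a lexicographic maximizer of the pair of utilities, and on the finite set of
attainable pairs the lexicographic order is that of `u_A + ε u_P` for small `ε`. -/
theorem eventually_isBestResponse (t : Fin m → ℝ) :
    ∀ᶠ ε : ℝ in nhdsWithin 0 (Set.Ioi 0), ∀ π : Strategy n m,
      I.IsOptimal (I.perturb t ε) π → I.IsBestResponse t π := by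
  have hF := (Strategy.finite_admissible (n := n) (m := m)).image
    fun π => toLex (I.agentUtility t π, I.principalUtility t π)
  filter_upwards [eventually_lex_lt_iff hF] with ε hε π hπ
  have key : ∀ π' : Strategy n m, π'.Admissible →
      ¬ (toLex (I.agentUtility t π, I.principalUtility t π) <
        toLex (I.agentUtility t π', I.principalUtility t π')) := by
    intro π' hπ' hlt
    have h := (hε _ ⟨π, hπ.1, rfl⟩ _ ⟨π', hπ', rfl⟩).1 hlt
    simp only [ofLex_toLex, ← agentUtility_perturb] at h
    exact absurd (hπ.2 π' hπ') (not_le.2 h)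
  refine ⟨⟨hπ.1, fun π' hπ' => ?_⟩, fun π' hπ' => ?_⟩
  · by_contra h
    exact key π' hπ' (Prod.Lex.toLex_lt_toLex.2 (Or.inl (not_le.1 h)))
  · by_contra h
    have h1 := hπ'.2 π hπ.1
    refine key π' hπ'.1 (Prod.Lex.toLex_lt_toLex.2 ?_)
    rcases h1.lt_or_eq with h1 | h1
    · exact Or.inl h1
    · exact Or.inr ⟨h1, not_le.1 h⟩

end Setting

/-! ### Index strategies -/

open Classical in
/-- Take the actions in the order of the list, keep a preferred outcome, which is updated by `upd`,
and halt before action `i` if the preferred outcome `j` satisfies `halts i j`. -/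
noncomputable def Strategy.index {n m : ℕ} (upd : Fin m → Fin m → Fin m)
    (halts : Fin n → Fin m → Prop) : List (Fin n) → Fin m → Strategy n m
  | [], j => halt j
  | i :: l, j => if halts i j then halt j else take i fun k => index upd halts l (upd j k)

namespace Strategy

variable {n m : ℕ} {upd : Fin m → Fin m → Fin m} {halts : Fin n → Fin m → Prop}

/-- The form `index` covers both the non-adaptive strategies of the theorem and the strategy behind
the program, whose comparisons are lexicographic and need no bijection. -/
theorem nonAdaptiveFrom_eq_index (ρ : Equiv.Perm (Fin m)) (τ : Fin n → Fin m)
    (l : List (Fin n)) (j : Fin m) :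
    nonAdaptiveFrom ρ τ l j =
      index (fun j k => if ρ j < ρ k then k else j) (fun i j => ρ (τ i) ≤ ρ j) l j := by
  induction l generalizing j with
  | nil => rfl
  | cons i l ih =>
    simp only [nonAdaptiveFrom, index, ih]

theorem valid_index (hupd : ∀ j k, upd j k = j ∨ upd j k = k) {l : List (Fin n)} (hl : l.Nodup)
    {S : Finset (Fin n)} (hS : ∀ i ∈ l, i ∉ S) {V : Finset (Fin m)} {j : Fin m} (hj : j ∈ V) :
    (index upd halts l j).Valid S V := by
  induction l generalizing S V j with
  | nil => exact hj
  | cons i l ih =>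
    rw [List.nodup_cons] at hl
    rw [index]
    split_ifs
    · exact hj
    · refine ⟨hS i (by simp), fun k => ih hl.2 ?_ ?_⟩
      · intro i' hi' h
        rcases Finset.mem_insert.1 h with rfl | h
        · exact hl.1 hi'
        · exact hS i' (by simp [hi']) h
      · rcases hupd j k with h | h <;> simp [h, hj]

theorem taken_index_subset (l : List (Fin n)) (j : Fin m) (x : Fin n → Fin m) {i : Fin n}
    (hi : i ∈ (index upd halts l j).taken x) : i ∈ l := by
  induction l generalizing j with
  | nil => simp [index, taken] at hi
  | cons k l ih =>
    rw [index] at hi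
    split_ifs at hi
    · simp [taken] at hi
    · rcases Finset.mem_insert.1 hi with rfl | h
      · simp
      · exact List.mem_cons_of_mem _ (ih _ h)

theorem final_index_update {l : List (Fin n)} {i : Fin n} (hi : i ∉ l) (j a : Fin m)
    (x : Fin n → Fin m) :
    (index upd halts l j).final (Function.update x i a) = (index upd halts l j).final x := by
  induction l generalizing j with
  | nil => rfl
  | cons k l ih =>
    rw [List.mem_cons, not_or] at hi
    rw [index]
    split_ifs
    · rfl
    · simp only [final, Function.update_of_ne (Ne.symm hi.1)]
      exact ih hi.2 _

end Strategy

/-! ### Capped values, the benchmark for all strategies -/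

section

variable {n m : ℕ} {v : Fin m → ℝ} {z : Fin n → ℝ}

/-- The largest value among `v j` and the capped values of the actions in the list. -/
noncomputable def cappedMax (v : Fin m → ℝ) (z : Fin n → ℝ) (x : Fin n → Fin m) :
    List (Fin n) → ℝ → ℝ
  | [], w => w
  | i :: l, w => max (cappedMax v z x l w) (min (v (x i)) (z i))

theorem le_cappedMax (x : Fin n → Fin m) (l : List (Fin n)) (w : ℝ) :
    w ≤ cappedMax v z x l w := by
  induction l with
  | nil => exact le_rfl
  | cons i l ih => exact ih.trans (le_max_left _ _)

theorem min_le_cappedMax (x : Fin n → Fin m) {l : List (Fin n)} (w : ℝ) {i : Fin n} (hi : i ∈ l) :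
    min (v (x i)) (z i) ≤ cappedMax v z x l w := by
  induction l with
  | nil => simp at hi
  | cons k l ih =>
    rcases List.mem_cons.1 hi with rfl | h
    · exact le_max_right _ _
    · exact (ih h).trans (le_max_left _ _)

theorem cappedMax_max (x : Fin n → Fin m) (l : List (Fin n)) (w w' : ℝ) :
    cappedMax v z x l (max w w') = max (cappedMax v z x l w) w' := by
  induction l with
  | nil => rfl
  | cons i l ih =>
    simp only [cappedMax, ih]
    exact max_right_comm _ _ _

theorem cappedMax_le (x : Fin n → Fin m) {l : List (Fin n)} {w b : ℝ} (hw : w ≤ b)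
    (h : ∀ i ∈ l, z i ≤ b) : cappedMax v z x l w ≤ b := by
  induction l with
  | nil => exact hw
  | cons i l ih =>
    exact max_le (ih fun k hk => h k (by simp [hk])) ((min_le_right _ _).trans (h i (by simp)))

/-- Holds for each realization. On halting, the sorted order puts all remaining caps below `v j`. On
continuing with `v (x i) ≥ z i`, the new preferred value dominates every later cap, and subtracting
its excess leaves exactly `z i`. -/
theorem index_payoff {upd : Fin m → Fin m → Fin m} {halts : Fin n → Fin m → Prop}
    (hupd : ∀ j k, v (upd j k) = max (v j) (v k)) (hhalts : ∀ i j, halts i j ↔ z i ≤ v j)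
    {l : List (Fin n)} (hl : l.Nodup) (hs : l.Pairwise fun a b => z b ≤ z a) (j : Fin m)
    (x : Fin n → Fin m) :
    v ((Strategy.index upd halts l j).final x) -
      ∑ i ∈ (Strategy.index upd halts l j).taken x, max (v (x i) - z i) 0 =
      cappedMax v z x l (v j) := by
  induction l generalizing j with
  | nil => simp [Strategy.index, Strategy.final, Strategy.taken, cappedMax]
  | cons i l ih =>
    rw [List.nodup_cons] at hl
    rw [List.pairwise_cons] at hs
    rw [Strategy.index]
    split_ifs with h
    · rw [hhalts] at h
      simp only [Strategy.final, Strategy.taken, Finset.sum_empty, sub_zero]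
      refine le_antisymm (le_cappedMax _ _ _) (cappedMax_le _ le_rfl ?_)
      intro k hk
      rcases List.mem_cons.1 hk with rfl | hk
      · exact h
      · exact (hs.1 k hk).trans h
    · rw [hhalts, not_le] at h
      have hi : i ∉ (Strategy.index upd halts l (upd j (x i))).taken x :=
        fun hi => hl.1 (Strategy.taken_index_subset _ _ _ hi)
      have := ih hl.2 hs.2 (upd j (x i))
      simp only [Strategy.final, Strategy.taken]
      rw [Finset.sum_insert hi, cappedMax]
      rw [hupd, cappedMax_max] at this
      have hle : cappedMax v z x l (v j) ≤ z i := cappedMax_le _ h.le hs.1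
      rcases le_total (v (x i)) (z i) with hx | hx
      · rw [min_eq_left hx, max_eq_right (sub_nonpos.2 hx), zero_add]
        exact this
      · rw [min_eq_right hx, max_eq_left (sub_nonneg.2 hx), max_eq_right hle]
        rw [max_eq_right (hle.trans hx)] at this
        linarith

end

namespace Setting

variable {n m : ℕ} [NeZero m] (I : Setting n m) {v : Fin m → ℝ} {z : Fin n → ℝ}

/-- `z i` is a reservation value of action `i` for the payoffs `v`. -/
def IsReservation (v : Fin m → ℝ) (z : Fin n → ℝ) : Prop :=
  ∀ i, ∑ a, I.prob i a * max (v a - z i) 0 = I.cost i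

/-- The costs may be replaced by the excess of the payoff over the reservation value. -/
theorem agentUtility_eq_of_isReservation (hz : I.IsReservation v z) (π : Strategy n m) :
    I.agentUtility v π =
      I.expect fun x => v (π.final x) - ∑ i ∈ π.taken x, max (v (x i) - z i) 0 := by
  classical
  rw [agentUtility, expect_sub, expect_sub]
  congr 1
  have h1 : ∀ g : Fin n → (Fin n → Fin m) → ℝ,
      I.expect (fun x => ∑ i ∈ π.taken x, g i x) =
        ∑ i, I.expect fun x => if i ∈ π.taken x then g i x else 0 := by
    intro g
    rw [← expect_sum]
    congr 1
    funext x
    rw [Finset.sum_ite_mem, Finset.univ_inter]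
  rw [h1, h1]
  refine Finset.sum_congr rfl fun i _ => ?_
  -- Whether `i` is taken is unaffected by redrawing its outcome, so the excess averages to `I.cost
  -- i` independently of that event.
  rw [I.expect_eq_sum_update i (fun x => if i ∈ π.taken x then max (v (x i) - z i) 0 else 0)]
  simp only [Strategy.mem_taken_update, Function.update_self]
  have h2 : ∀ c : ℝ, I.expect (fun x => if i ∈ π.taken x then c else 0) =
      c * I.expect (fun x => if i ∈ π.taken x then 1 else 0) := by
    intro c
    rw [← expect_mul]
    congr 1
    funext x
    split_ifs <;> simp
  rw [h2]
  simp only [h2 (max _ _), ← mul_assoc]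
  rw [← Finset.sum_mul, hz i]

/-- The index strategy for the reservation values is optimal. -/
theorem isOptimal_index (hz : I.IsReservation v z) {upd : Fin m → Fin m → Fin m}
    {halts : Fin n → Fin m → Prop} (hupd' : ∀ j k, upd j k = j ∨ upd j k = k)
    (hupd : ∀ j k, v (upd j k) = max (v j) (v k)) (hhalts : ∀ i j, halts i j ↔ z i ≤ v j)
    {l : List (Fin n)} (hl : l.Nodup) (hs : l.Pairwise fun a b => z b ≤ z a)
    (hmem : ∀ i, i ∈ l) : I.IsOptimal v (Strategy.index upd halts l 0) := by
  refine ⟨Strategy.valid_index hupd' hl (by simp) (by simp), fun π hπ => ?_⟩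
  rw [I.agentUtility_eq_of_isReservation hz, I.agentUtility_eq_of_isReservation hz]
  refine I.expect_mono fun x => ?_
  rw [index_payoff hupd hhalts hl hs]
  -- The selected outcome is the zero outcome or that of a taken action; in the second case its own
  -- excess term already cuts the payoff down to the capped value.
  rcases Strategy.final_mem hπ x with h | ⟨i, hi, h⟩
  · rw [Finset.mem_singleton] at h
    rw [h]
    exact (sub_le_self _ (Finset.sum_nonneg fun _ _ => le_max_right _ _)).trans
      (le_cappedMax _ _ _)
  · refine le_trans ?_ (min_le_cappedMax x _ (hmem i))
    have := Finset.single_le_sum (f := fun i => max (v (x i) - z i) 0)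
      (fun _ _ => le_max_right _ _) hi
    rw [h]
    rcases le_total (v (x i)) (z i) with hx | hx
    · rw [max_eq_right (sub_nonpos.2 hx)] at this
      rw [min_eq_left hx]
      linarith
    · rw [max_eq_left (sub_nonneg.2 hx)] at this
      rw [min_eq_right hx]
      linarith

/-- Backward recursion for the expected value of a function of the final outcome. -/
theorem expect_final_index (d : Fin m → ℝ) {upd : Fin m → Fin m → Fin m}
    {halts : Fin n → Fin m → Prop} {i : Fin n} {l : List (Fin n)} (hi : i ∉ l) {j : Fin m}
    (hj : ¬ halts i j) :
    I.expect (fun x => d ((Strategy.index upd halts (i :: l) j).final x)) =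
      ∑ a, I.prob i a * I.expect fun x => d ((Strategy.index upd halts l (upd j a)).final x) := by
  rw [I.expect_eq_sum_update i]
  simp only [Strategy.index, hj, if_false, Strategy.final, Function.update_self,
    Strategy.final_index_update hi]

/-! ### Reservation values -/

/-- Criterion for reservation values as the largest threshold quotient. -/
theorem isReservation_of_max
    (hub : ∀ i j, 0 < (∑ a, if v a < v j then 0 else I.prob i a) →
      ((∑ a, if v a < v j then 0 else I.prob i a * v a) - I.cost i) /
        (∑ a, if v a < v j then 0 else I.prob i a) ≤ z i)
    (hex : ∀ i, ∃ j, 0 < (∑ a, if v a < v j then 0 else I.prob i a) ∧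
      ((∑ a, if v a < v j then 0 else I.prob i a * v a) - I.cost i) /
        (∑ a, if v a < v j then 0 else I.prob i a) = z i) :
    I.IsReservation v z := by
  have hlin : ∀ i j, (∑ a, if v a < v j then 0 else I.prob i a * (v a - z i)) =
      (∑ a, if v a < v j then 0 else I.prob i a * v a) -
        z i * ∑ a, if v a < v j then 0 else I.prob i a := by
    intro i j
    rw [Finset.mul_sum, ← Finset.sum_sub_distrib]
    refine Finset.sum_congr rfl fun a _ => ?_
    split_ifs <;> ring
  intro i
  apply le_antisymm
  · by_cases hne : ∃ a, z i < v a
    -- The least payoff above `z i` is the threshold at which the upper sum equals the expected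
    -- positive part.
    · obtain ⟨j, hj, hmin⟩ := Finset.exists_min_image
        (Finset.univ.filter fun a => z i < v a) v (by
          obtain ⟨a, ha⟩ := hne
          exact ⟨a, by simpa using ha⟩)
      simp only [Finset.mem_filter, Finset.mem_univ, true_and] at hj hmin
      have heq : ∑ a, I.prob i a * max (v a - z i) 0 =
          ∑ a, if v a < v j then 0 else I.prob i a * (v a - z i) := by
        refine Finset.sum_congr rfl fun a _ => ?_
        split_ifs with h
        · rw [max_eq_right, mul_zero]
          by_contra h'
          exact absurd (hmin a (by linarith)) (not_le.2 h)
        · rw [max_eq_left]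
          linarith
      rw [heq, hlin]
      have h0 : 0 ≤ ∑ a, if v a < v j then 0 else I.prob i a :=
        Finset.sum_nonneg fun a _ => by split_ifs <;> simp [I.prob_nonneg]
      rcases h0.lt_or_eq with h0 | h0
      · have := hub i j h0
        rw [div_le_iff₀ h0] at this
        linarith
      -- With zero mass above the threshold there is no quotient, but then the expected excess
      -- vanishes.
      · have hz : ∀ a, (if v a < v j then 0 else I.prob i a) = 0 := by
          intro a
          exact (Finset.sum_eq_zero_iff_of_nonneg
            (fun a _ => by split_ifs <;> simp [I.prob_nonneg])).1 h0.symm a (Finset.mem_univ a)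
        have : (∑ a, if v a < v j then 0 else I.prob i a * v a) = 0 := by
          refine Finset.sum_eq_zero fun a _ => ?_
          have := hz a
          split_ifs at this ⊢
          · rfl
          · rw [this, zero_mul]
        rw [this, ← h0]
        simpa using I.cost_nonneg i
    · push Not at hne
      rw [Finset.sum_eq_zero fun a _ => by
        rw [max_eq_right (sub_nonpos.2 (hne a)), mul_zero]]
      exact I.cost_nonneg i
  -- At the maximizing threshold the cost is a partial sum of `p (v - z)`, which the sum of positive
  -- parts dominates.
  · obtain ⟨j, h0, hj⟩ := hex i
    rw [div_eq_iff h0.ne'] at hj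
    have : I.cost i = ∑ a, if v a < v j then 0 else I.prob i a * (v a - z i) := by
      rw [hlin]
      linarith
    rw [this]
    refine Finset.sum_le_sum fun a _ => ?_
    split_ifs
    · exact mul_nonneg (I.prob_nonneg i a) (le_max_right _ _)
    · exact mul_le_mul_of_nonneg_left (le_max_left _ _) (I.prob_nonneg i a)

/-- The smallest payoff as threshold has mass one, so a largest quotient exists. Since costs are
non-negative, it is at most the largest payoff; this bound lets an outcome serve as the halting
threshold of a non-adaptive strategy. -/
theorem exists_isReservation (v : Fin m → ℝ) :
    ∃ z : Fin n → ℝ, I.IsReservation v z ∧ ∀ i, ∃ j, z i ≤ v j := by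
  have hpos : ∀ i, ∃ j, 0 < ∑ a, if v a < v j then 0 else I.prob i a := by
    intro i
    obtain ⟨j, -, hj⟩ := Finset.exists_min_image Finset.univ v Finset.univ_nonempty
    refine ⟨j, ?_⟩
    have : (∑ a, if v a < v j then 0 else I.prob i a) = 1 := by
      rw [← I.prob_sum i]
      exact Finset.sum_congr rfl fun a _ => if_neg (not_lt.2 (hj a (Finset.mem_univ a)))
    rw [this]
    exact one_pos
  have hmax := fun i => Finset.exists_max_image
    (Finset.univ.filter fun j => 0 < ∑ a, if v a < v j then 0 else I.prob i a)
    (fun j => ((∑ a, if v a < v j then 0 else I.prob i a * v a) - I.cost i) /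
        (∑ a, if v a < v j then 0 else I.prob i a)) (by
      obtain ⟨j, hj⟩ := hpos i
      exact ⟨j, by simpa using hj⟩)
  simp only [Finset.mem_filter, Finset.mem_univ, true_and] at hmax
  choose k hk hk' using hmax
  refine ⟨_, I.isReservation_of_max (fun i j hj => hk' i j hj) (fun i => ⟨k i, hk i, rfl⟩), ?_⟩
  intro i
  obtain ⟨j, -, hj⟩ := Finset.exists_max_image Finset.univ v Finset.univ_nonempty
  refine ⟨j, ?_⟩
  rw [div_le_iff₀ (hk i), Finset.mul_sum]
  refine (sub_le_self _ (I.cost_nonneg i)).trans (Finset.sum_le_sum fun a _ => ?_)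
  split_ifs
  · simp
  · rw [mul_comm]
    exact mul_le_mul_of_nonneg_right (hj a (Finset.mem_univ a)) (I.prob_nonneg i a)

/-- Some non-adaptive strategy is optimal. -/
theorem exists_isOptimal_nonAdaptive (v : Fin m → ℝ) :
    ∃ (σ : Equiv.Perm (Fin n)) (ρ : Equiv.Perm (Fin m)) (τ : Fin n → Fin m),
      I.IsOptimal v (Strategy.nonAdaptive σ ρ τ) := by
  obtain ⟨z, hz, hzv⟩ := I.exists_isReservation v
  -- The preference must be injective, so equal payoffs are separated by their position in the
  -- sorted order.
  set ρ : Equiv.Perm (Fin m) := (Tuple.sort v)⁻¹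
  have hρ : ∀ {j k}, ρ j ≤ ρ k → v j ≤ v k := by
    intro j k h
    have := Tuple.monotone_sort v h
    simpa [ρ] using this
  set σ : Equiv.Perm (Fin n) := Tuple.sort fun i => - z i
  -- `τ i` will be the `ρ`-least outcome worth at least `z i`; then `ρ (τ i) ≤ ρ j` is equivalent to
  -- `z i ≤ v j`.
  have hmin := fun i => Finset.exists_min_image (Finset.univ.filter fun j => z i ≤ v j) ρ (by
    obtain ⟨j, hj⟩ := hzv i
    exact ⟨j, by simpa using hj⟩)
  simp only [Finset.mem_filter, Finset.mem_univ, true_and] at hmin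
  choose τ hτ hτ' using hmin
  refine ⟨σ, ρ, τ, ?_⟩
  rw [Strategy.nonAdaptive, Strategy.nonAdaptiveFrom_eq_index]
  refine I.isOptimal_index hz ?_ ?_ ?_ (List.nodup_ofFn.2 σ.injective) ?_ ?_
  · intro j k
    split_ifs <;> simp
  · intro j k
    split_ifs with h
    · exact (max_eq_right (hρ h.le)).symm
    · exact (max_eq_left (hρ (not_lt.1 h))).symm
  · exact fun i j => ⟨fun h => (hτ i).trans (hρ h), fun h => hτ' i j h⟩
  · rw [List.pairwise_ofFn]
    intro a b hab
    have := Tuple.monotone_sort (fun i => - z i) hab.le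
    simpa using this
  · intro i
    rw [List.mem_ofFn]
    exact σ.surjective i

theorem exists_perturb_pos {t : Fin m → ℝ} (ht : IsContract t) :
    ∃ ε₀ : ℝ, 0 < ε₀ ∧ ∀ ε : ℝ, 0 < ε → ε < ε₀ →
      IsContract (I.perturb t ε) ∧
      (∀ π : Strategy n m, I.IsOptimal (I.perturb t ε) π → I.IsBestResponse t π) ∧
      ∃ (σ : Equiv.Perm (Fin n)) (ρ : Equiv.Perm (Fin m)) (τ : Fin n → Fin m),
        I.IsOptimal (I.perturb t ε) (Strategy.nonAdaptive σ ρ τ) := by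
  obtain ⟨u, hu, h⟩ := mem_nhdsGT_iff_exists_Ioo_subset.1 (I.eventually_isBestResponse t)
  refine ⟨min u 1, lt_min hu one_pos, fun ε h0 h1 => ?_⟩
  rw [lt_min_iff] at h1
  exact ⟨I.isContract_perturb ht h0.le h1.2.le, h ⟨h0, h1.1⟩, I.exists_isOptimal_nonAdaptive _⟩

end Setting

/-! ### The computed quantities -/

/-- Extension of a vector by zero to all indices. -/
def extendZero {m : ℕ} (f : Fin m → ℝ) (k : ℕ) : ℝ := if h : k < m then f ⟨k, h⟩ else 0

@[simp] theorem extendZero_coe {m : ℕ} (f : Fin m → ℝ) (k : Fin m) : extendZero f k = f k := by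
  simp [extendZero]

namespace Setting

variable {n m : ℕ} [NeZero m] (I : Setting n m) (t : Fin m → ℝ)

/-- The probability that action `i` leads to outcome `a`, for all indices. -/
noncomputable def probAt (i a : ℕ) : ℝ := if h : i < n then extendZero (I.prob ⟨i, h⟩) a else 0

@[simp] theorem probAt_coe (i : Fin n) (a : Fin m) : I.probAt i a = I.prob i a := by
  simp [probAt]

/-- The principal's gain from an outcome. -/
noncomputable def gain (k : ℕ) : ℝ := extendZero I.reward k - extendZero t k

/-- The payment for an outcome, with ties broken in favor of the principal. -/
noncomputable def payoff (k : ℕ) : ℝ ×ₗ ℝ := toLex (extendZero t k, I.gain t k)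

/-- Sum over those outcomes below `k` whose payoff is at least that of `j`. -/
noncomputable def upperSum (f : ℕ → ℝ) (j k : ℕ) : ℝ :=
  ∑ a ∈ Finset.range k, if I.payoff t a < I.payoff t j then 0 else f a

/-- The threshold quotient of action `i` for outcome `j`. -/
noncomputable def quotient (i j : ℕ) : ℝ ×ₗ ℝ :=
  toLex ((-extendZero I.cost i + I.upperSum t (fun a => I.probAt i a * extendZero t a) j m) /
      I.upperSum t (I.probAt i) j m,
    I.upperSum t (fun a => I.probAt i a * I.gain t a) j m / I.upperSum t (I.probAt i) j m)

/-- The largest threshold quotient of action `i` for the first `k` outcomes. -/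
noncomputable def maxQuotient (i : ℕ) : ℕ → ℝ ×ₗ ℝ
  -- A start value that never survives: for non-negative payments the quotient at the smallest
  -- payoff has first coordinate at least the negated cost.
  | 0 => toLex (-extendZero I.cost i - 1, 0)
  | j + 1 =>
      if 0 < I.upperSum t (I.probAt i) j m ∧ maxQuotient i j < I.quotient t i j then
        I.quotient t i j
      else maxQuotient i j

/-- The lexicographic reservation value. -/
noncomputable def reservation (i : ℕ) : ℝ ×ₗ ℝ := I.maxQuotient t i m

/-- The better one of two outcomes. -/
noncomputable def better (j a : ℕ) : ℕ := if I.payoff t j < I.payoff t a then a else j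

/-- The principal's expected gain when the actions in the list are still available and `j` is the
best outcome so far. -/
noncomputable def value : List (Fin n) → ℕ → ℝ
  | [], j => I.gain t j
  | i :: l, j =>
      if I.payoff t j < I.reservation t i then
        ∑ a ∈ Finset.range m, I.probAt i a * value l (I.better t j a)
      else I.gain t j

theorem quotient_le_maxQuotient (i : ℕ) {j k : ℕ} (hj : j < k)
    (h0 : 0 < I.upperSum t (I.probAt i) j m) : I.quotient t i j ≤ I.maxQuotient t i k := by
  induction k with
  | zero => omega
  | succ k ih =>
    rw [maxQuotient]
    rcases Nat.lt_succ_iff_lt_or_eq.1 hj with h | rfl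
    · split_ifs with h'
      · exact (ih h).trans h'.2.le
      · exact ih h
    · split_ifs with h'
      · exact le_rfl
      · rw [not_and, not_lt] at h'
        exact h' h0

theorem maxQuotient_eq (i k : ℕ) :
    I.maxQuotient t i k = toLex (-extendZero I.cost i - 1, 0) ∨
      ∃ j < k, 0 < I.upperSum t (I.probAt i) j m ∧ I.maxQuotient t i k = I.quotient t i j := by
  induction k with
  | zero => exact Or.inl rfl
  | succ k ih =>
    rw [maxQuotient]
    split_ifs with h
    · exact Or.inr ⟨k, by omega, h.1, rfl⟩
    · rcases ih with h' | ⟨j, hj, h'⟩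
      · exact Or.inl h'
      · exact Or.inr ⟨j, by omega, h'⟩

/-- The recursion `value` is `expect_final_index` for the index strategy with lexicographic
comparisons, applied to the principal's gain. -/
theorem value_eq_expect {l : List (Fin n)} (hl : l.Nodup) (j : Fin m) :
    I.value t l j = I.expect fun x => I.reward ((Strategy.index
        (fun j k => if I.payoff t j < I.payoff t k then k else j)
        (fun i j => ¬ I.payoff t j < I.reservation t i) l j).final x) -
      t ((Strategy.index
        (fun j k => if I.payoff t j < I.payoff t k then k else j)
        (fun i j => ¬ I.payoff t j < I.reservation t i) l j).final x) := by
  induction l generalizing j with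
  | nil => simp [value, Strategy.index, Strategy.final, expect_const, gain]
  | cons i l ih =>
    rw [List.nodup_cons] at hl
    by_cases h : I.payoff t j < I.reservation t i
    · rw [I.expect_final_index (fun j => I.reward j - t j) hl.1 (by simpa using h), value,
        if_pos h, Finset.sum_range]
      refine Finset.sum_congr rfl fun a _ => ?_
      rw [probAt_coe, ← ih hl.2, better]
      split_ifs <;> rfl
    · simp [value, Strategy.index, Strategy.final, expect_const, gain, h]

/-- The value of all actions, ordered by their reservation values, is the principal's utility. -/
theorem isPrincipalUtility_value (ht : IsContract t) {l : List (Fin n)} (hl : l.Nodup)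
    (hmem : ∀ i, i ∈ l)
    (hs : l.Pairwise fun a b : Fin n => I.reservation t b ≤ I.reservation t a) :
    I.IsPrincipalUtility t (I.value t l 0) := by
  -- All pairs whose order matters. One `ε` is chosen for which `φ` preserves and reflects the order
  -- on `F` and optimal strategies of the perturbed contract are best responses.
  let F : Set (ℝ ×ₗ ℝ) := Set.range (fun j : Fin m => I.payoff t j) ∪
    (Set.range (fun i : Fin n => I.reservation t i) ∪
      Set.range (fun p : Fin n × Fin m => I.quotient t p.1 p.2))
  have hF : F.Finite :=
    (Set.finite_range _).union ((Set.finite_range _).union (Set.finite_range _))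
  obtain ⟨ε, ⟨hlex, hbest⟩, hε0, hε1⟩ := (((eventually_lex_lt_iff hF).and
    (I.eventually_isBestResponse t)).and (Ioo_mem_nhdsGT (zero_lt_one (α := ℝ)))).exists
  let φ : ℝ ×ₗ ℝ → ℝ := fun x => (ofLex x).1 + ε * (ofLex x).2
  have hlt : ∀ x ∈ F, ∀ y ∈ F, (x < y ↔ φ x < φ y) := hlex
  have hle : ∀ x ∈ F, ∀ y ∈ F, (x ≤ y ↔ φ x ≤ φ y) := fun x hx y hy => by
    rw [← not_lt, ← not_lt, hlt y hy x hx]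
  have hFv : ∀ j : Fin m, I.payoff t j ∈ F := fun j => Or.inl ⟨j, rfl⟩
  have hFz : ∀ i : Fin n, I.reservation t i ∈ F := fun i => Or.inr (Or.inl ⟨i, rfl⟩)
  have hFq : ∀ (i : Fin n) (j : Fin m), I.quotient t i j ∈ F :=
    fun i j => Or.inr (Or.inr ⟨(i, j), rfl⟩)
  have hv : ∀ j : Fin m, φ (I.payoff t j) = I.perturb t ε j := by
    intro j
    simp [φ, payoff, gain, perturb]
  have hv0 : ∀ j, 0 ≤ I.perturb t ε j := I.isContract_perturb ht hε0.le hε1.le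
  have hvlt : ∀ a j : Fin m, I.payoff t a < I.payoff t j ↔ I.perturb t ε a < I.perturb t ε j := by
    intro a j
    rw [hlt _ (hFv a) _ (hFv j), hv, hv]
  have hsum : ∀ (f : ℕ → ℝ) (j : Fin m), I.upperSum t f j m =
      ∑ a : Fin m, if I.perturb t ε a < I.perturb t ε j then 0 else f a := by
    intro f j
    rw [upperSum, Finset.sum_range]
    refine Finset.sum_congr rfl fun a _ => ?_
    simp only [hvlt]
  have hmass : ∀ (i : Fin n) (j : Fin m), I.upperSum t (I.probAt i) j m =
      ∑ a : Fin m, if I.perturb t ε a < I.perturb t ε j then 0 else I.prob i a := by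
    intro i j
    simp [hsum]
  -- `φ` is linear and the mass is a plain real, so `φ` maps the quotient of pairs to the quotient
  -- for the perturbed payments.
  have hq : ∀ (i : Fin n) (j : Fin m), φ (I.quotient t i j) =
      ((∑ a, if I.perturb t ε a < I.perturb t ε j then 0 else I.prob i a * I.perturb t ε a) -
        I.cost i) / ∑ a, if I.perturb t ε a < I.perturb t ε j then 0 else I.prob i a := by
    intro i j
    have : (∑ a, if I.perturb t ε a < I.perturb t ε j then 0
        else I.prob i a * I.perturb t ε a) =
        I.upperSum t (fun a => I.probAt i a * extendZero t a) j m +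
          ε * I.upperSum t (fun a => I.probAt i a * I.gain t a) j m := by
      rw [hsum, hsum, Finset.mul_sum, ← Finset.sum_add_distrib]
      refine Finset.sum_congr rfl fun a _ => ?_
      split_ifs
      · simp
      · simp only [probAt_coe, ← hv a, φ, payoff, ofLex_toLex]
        ring
    rw [this, ← hmass]
    simp only [φ, quotient, ofLex_toLex, extendZero_coe]
    ring
  have hz : I.IsReservation (I.perturb t ε) fun i => φ (I.reservation t i) := by
    apply I.isReservation_of_max
    · intro i j h0
      rw [← hq, ← hle _ (hFq i j) _ (hFz i)]
      exact I.quotient_le_maxQuotient t i j.2 (by rw [hmass]; exact h0)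
    · intro i
      rcases I.maxQuotient_eq t i m with h | ⟨j, hj, h0, h⟩
      -- The threshold at the least perturbed payment has mass one and quotient at least `-c_i`,
      -- which beats the start value `-c_i - 1`.
      · exfalso
        obtain ⟨j, -, hj⟩ :=
          Finset.exists_min_image Finset.univ (I.perturb t ε) Finset.univ_nonempty
        have hif : ∀ f : Fin m → ℝ,
            (∑ a, if I.perturb t ε a < I.perturb t ε j then 0 else f a) = ∑ a, f a := by
          intro f
          exact Finset.sum_congr rfl fun a _ => if_neg (not_lt.2 (hj a (Finset.mem_univ a)))
        have h1 := I.quotient_le_maxQuotient t i j.2 (by rw [hmass, hif, I.prob_sum]; exact one_pos)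
        have h2 := (hle _ (hFq i j) _ (hFz i)).1 h1
        rw [hq, hif, hif, I.prob_sum, div_one, reservation, h] at h2
        have h3 : 0 ≤ ∑ a, I.prob i a * I.perturb t ε a :=
          Finset.sum_nonneg fun a _ => mul_nonneg (I.prob_nonneg i a) (hv0 a)
        simp only [φ, ofLex_toLex, extendZero_coe] at h2
        linarith
      · refine ⟨⟨j, hj⟩, ?_, ?_⟩
        · rw [← hmass]
          exact h0
        · rw [← hq, reservation, h]
  have hopt : I.IsOptimal (I.perturb t ε) (Strategy.index
        (fun j k => if I.payoff t j < I.payoff t k then k else j)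
        (fun i j => ¬ I.payoff t j < I.reservation t i) l 0) := by
    refine I.isOptimal_index hz ?_ ?_ ?_ hl ?_ hmem
    · intro j k
      split_ifs <;> simp
    · intro j k
      split_ifs with h
      · exact (max_eq_right ((hvlt j k).1 h).le).symm
      · rw [hvlt, not_lt] at h
        exact (max_eq_left h).symm
    · intro i j
      rw [not_lt, hle _ (hFz i) _ (hFv j), hv]
    · exact hs.imp fun {a b} h => (hle _ (hFz b) _ (hFz a)).1 h
  refine ⟨_, hbest _ hopt, ?_⟩
  have := I.value_eq_expect t hl (0 : Fin m)
  rw [Fin.val_zero] at this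
  rw [this]
  rfl

end Setting

/-! ### The program -/

namespace Prog

open Instr

/-- Branch on the lexicographic comparison of two pairs of real registers. -/
def lexLt (a b c d : ℕ) (P Q : Prog) : Prog :=
  cond (.rlt a c) P (cond (.rlt c a) Q (cond (.rlt b d) P Q))

/-- Real array `4` receives the gains, real array `5` the values for no available actions. -/
def gainBody : Prog := block [
  instr (rload 1 1 4), instr (rload 2 0 4), instr (rarith .sub 1 1 2), instr (rstore 4 4 1),
  instr (rstore 5 4 1), instr (iadd 4 4 2)]

def gains : Prog := loop (.ilt 4 1) gainBody

/-- Accumulation of the three sums of a threshold quotient in the real registers `3`, `4`, `5`. -/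
def upperBody : Prog := block [
  instr (rload 6 0 9), instr (rload 7 4 9), instr (rload 8 3 10),
  lexLt 6 7 1 2 skip (block [
    instr (rarith .mul 13 8 6), instr (rarith .add 3 3 13),
    instr (rarith .mul 13 8 7), instr (rarith .add 4 4 13),
    instr (rarith .add 5 5 8)]),
  instr (iadd 9 9 2), instr (iadd 10 10 2)]

def uppers : Prog := loop (.ilt 9 1) upperBody

def quotientInit : Prog := block [
  instr (rload 1 0 8), instr (rload 2 4 8), instr (rcopy 3 10), instr (rcopy 4 20),
  instr (rcopy 5 20), instr (iconst 9 0), instr (icopy 10 6)]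

def quotientFinish : Prog := block [
  -- Real register `20` holds `0`; quotients are formed only when the mass is positive.
  cond (.rlt 20 5) (block [
    instr (rarith .div 3 3 5), instr (rarith .div 4 4 5),
    lexLt 11 12 3 4 (block [instr (rcopy 11 3), instr (rcopy 12 4)]) skip]) skip,
  instr (iadd 8 8 2)]

/-- The largest threshold quotient, in the real registers `11` and `12`. -/
def quotients : Prog := loop (.ilt 8 1) (seq quotientInit (seq uppers quotientFinish))

def reservationInit : Prog := block [
  instr (rload 9 2 5), instr (rarith .sub 10 20 9), instr (rarith .sub 11 10 21),
  instr (rcopy 12 20), instr (iconst 8 0)]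

/-- For action `i`, integer registers `6` and `7` hold `i * m` and `n + i`; they are advanced by
addition, as integers cannot be multiplied in one step. -/
def reservationFinish : Prog := block [
  instr (rstore 6 5 11), instr (rstore 7 5 12), instr (istore 0 5 6), instr (istore 1 7 5),
  instr (iadd 5 5 2), instr (iadd 6 6 1), instr (iadd 7 7 2)]

/-- The reservation values, in the real arrays `6` and `7`; the offsets of the actions in the
table of probabilities, in the integer array `0`; the leaves of the tournament, in the integer
array `1`. -/
def reservations : Prog :=
  loop (.ilt 5 0) (seq reservationInit (seq quotients reservationFinish))

/-- Recompute the winner of the tournament at the inner node in integer register `r`. -/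
def node (r : ℕ) : Prog := block [
  instr (iadd 12 r r), instr (iadd 13 12 2), instr (iload 14 1 12), instr (iload 15 1 13),
  cond (.ilt 14 0)
    (cond (.ilt 15 0)
      (block [instr (rload 1 6 14), instr (rload 2 7 14), instr (rload 3 6 15),
        instr (rload 4 7 15), lexLt 3 4 1 2 (instr (icopy 16 15)) (instr (icopy 16 14))])
      (instr (icopy 16 14)))
    (instr (icopy 16 15)),
  instr (istore 1 r 16)]

/-- `node` leaves the two children in registers `12` and `13`. Their parent is recorded because the
machine cannot halve an integer in one step. -/
def buildBody : Prog := block [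
  instr (isub 11 11 2), node 11, instr (istore 2 12 11), instr (istore 2 13 11)]

/-- Build the tournament and the table of parents (integer array `2`). -/
def build : Prog := loop (.ilt 2 11) buildBody

/-- The value of the better of two outcomes is one of two stored values, so a comparison selects it;
real register `3` holds the value of the current best outcome. -/
def sumBody : Prog := block [
  instr (rload 6 0 9), instr (rload 7 4 9), instr (rload 8 3 10), instr (rload 9 5 9),
  lexLt 1 2 6 7 skip (instr (rcopy 9 3)),
  instr (rarith .mul 13 8 9), instr (rarith .add 4 4 13),
  instr (iadd 9 9 2), instr (iadd 10 10 2)]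

/-- The expected value after taking the action, in the real register `4`. -/
def sums : Prog := loop (.ilt 9 1) sumBody

def valueInit : Prog := block [
  instr (rload 1 0 8), instr (rload 2 4 8), instr (rload 3 5 8), instr (rcopy 4 20),
  instr (iconst 9 0), instr (icopy 10 19)]

def valueFinish : Prog := block [
  lexLt 1 2 14 15 (instr (rstore 8 8 4)) (instr (rstore 8 8 2)), instr (iadd 8 8 2)]

/-- The new values, in the real array `8`. -/
def values : Prog := loop (.ilt 8 1) (seq valueInit (seq sums valueFinish))

/-- Array `5` must keep the old values until every new value is computed, hence the detour through
array `8`. -/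
def copyBody : Prog := block [instr (rload 1 8 8), instr (rstore 5 8 1), instr (iadd 8 8 2)]

def copy : Prog := loop (.ilt 8 1) copyBody

def pathBody : Prog := block [instr (iload 20 2 20), node 20]

/-- Recompute the tournament on the path from a leaf to the root. -/
def path : Prog := loop (.ilt 2 20) pathBody

def extractInit : Prog := block [
  instr (iload 18 1 2), instr (iload 19 0 18), instr (rload 14 6 18), instr (rload 15 7 18),
  instr (iconst 8 0)]

/-- The entry `n` marks a leaf without a candidate. -/
def removeLeaf : Prog := block [instr (iadd 20 0 18), instr (istore 1 20 0)]

def extractBody : Prog :=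
  seq extractInit (seq values (seq (instr (iconst 8 0)) (seq copy (seq removeLeaf
    (seq path (instr (iadd 17 17 2)))))))

/-- Process the actions by increasing reservation value. -/
def extract : Prog := loop (.ilt 17 0) extractBody

/-- Real register `0` already receives the gain of the zero outcome, which is the answer when there
are no actions. Integer register `3` and real register `20` stay `0`. -/
def start : Prog := block [
  instr (iconst 2 1), instr (rconst 21 1), instr (rload 1 1 3), instr (rload 2 0 3),
  instr (rarith .sub 0 1 2), instr (icopy 7 0), instr (icopy 11 0)]

/-- The program for the principal's utility. -/
def principalUtility : Prog :=
  seq start (cond (.ilt 3 0)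
    (seq gains (seq reservations (seq build (seq extract (instr (rload 0 5 3)))))) skip)

/-- The program does not change the input and the constants `0` and `1`. -/
def keepsInput (P : Prog) : Bool :=
  !(P.any (writesIreg 0) || P.any (writesIreg 1) || P.any (writesIreg 2) ||
    P.any (writesIreg 3) || P.any (writesRreg 20) || P.any (writesRreg 21) ||
    P.any (writesRarr 0) || P.any (writesRarr 1) || P.any (writesRarr 2) ||
    P.any (writesRarr 3))

theorem wp_lexLt {G : ℝ → Prop} {a b c d : ℕ} {P Q : Prog} {R : Memory → Prop} {s : Memory} :
    (lexLt a b c d P Q).wp G R s ↔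
      (toLex (s.rreg a, s.rreg b) < toLex (s.rreg c, s.rreg d) → P.wp G R s) ∧
      (¬ toLex (s.rreg a, s.rreg b) < toLex (s.rreg c, s.rreg d) → Q.wp G R s) := by
  simp only [lexLt, wp, Test.Holds, Prod.Lex.toLex_lt_toLex]
  rcases lt_trichotomy (s.rreg a) (s.rreg c) with h | h | h
  · simp [h]
  · simp [h]
  · simp [h, h.not_gt, h.ne']

end Prog

/-! ### Memory invariants, gains and reservation values -/

section

open Prog

/-- The input and the constants `0` and `1` are in the memory. -/
structure HasInput {n m : ℕ} [NeZero m] (I : Setting n m) (t : Fin m → ℝ) (s : Memory) : Prop where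
  ireg_zero : s.ireg 0 = n
  ireg_one : s.ireg 1 = m
  ireg_two : s.ireg 2 = 1
  ireg_three : s.ireg 3 = 0
  rreg_zero : s.rreg 20 = 0
  rreg_one : s.rreg 21 = 1
  payment : ∀ j < m, s.rarr 0 j = extendZero t j
  reward : ∀ j < m, s.rarr 1 j = extendZero I.reward j
  cost : ∀ i < n, s.rarr 2 i = extendZero I.cost i
  prob : ∀ i < n, ∀ a < m, s.rarr 3 (i * m + a) = I.probAt i a

/-- All numbers that the program computes satisfy `G`. -/
structure GoodNumbers {n m : ℕ} [NeZero m] (I : Setting n m) (t : Fin m → ℝ) (G : ℝ → Prop) :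
    Prop where
  zero : G 0
  one : G 1
  payment : ∀ j, G (t j)
  reward : ∀ j, G (I.reward j)
  cost : ∀ i, G (I.cost i)
  prob : ∀ i j, G (I.prob i j)
  gain : ∀ j < m, G (I.gain t j)
  neg_cost : ∀ i < n, G (-extendZero I.cost i)
  neg_cost_sub_one : ∀ i < n, G (-extendZero I.cost i - 1)
  prob_mul_payment : ∀ i < n, ∀ a < m, G (I.probAt i a * extendZero t a)
  prob_mul_gain : ∀ i < n, ∀ a < m, G (I.probAt i a * I.gain t a)
  upperSum_payment : ∀ i < n, ∀ j < m, ∀ k ≤ m, G (-extendZero I.cost i +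
    I.upperSum t (fun a => I.probAt i a * extendZero t a) j k)
  upperSum_gain : ∀ i < n, ∀ j < m, ∀ k ≤ m,
    G (I.upperSum t (fun a => I.probAt i a * I.gain t a) j k)
  upperSum_prob : ∀ i < n, ∀ j < m, ∀ k ≤ m, G (I.upperSum t (I.probAt i) j k)
  quotient : ∀ i < n, ∀ j < m, 0 < I.upperSum t (I.probAt i) j m →
    G (ofLex (I.quotient t i j)).1 ∧ G (ofLex (I.quotient t i j)).2
  prob_mul_value : ∀ l : List (Fin n), l.Nodup → ∀ i < n, ∀ a < m, ∀ j < m,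
    G (I.probAt i a * I.value t l j)
  sum_value : ∀ l : List (Fin n), l.Nodup → ∀ i < n, ∀ j < m, ∀ k ≤ m,
    G (∑ a ∈ Finset.range k, I.probAt i a * I.value t l (I.better t j a))

namespace HasInput

variable {n m : ℕ} [NeZero m] {I : Setting n m} {t : Fin m → ℝ} {s s' : Memory} {P : Prog}

/-- The written registers and arrays are read off the program text, so for a concrete program `hP`
is `rfl`. -/
theorem unchanged (h : HasInput I t s) (hu : Unchanged P s s') (hP : P.keepsInput = true) :
    HasInput I t s' := by
  simp only [keepsInput, Bool.not_eq_true', Bool.or_eq_false_iff] at hP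
  obtain ⟨⟨⟨⟨⟨⟨⟨⟨⟨h0, h1⟩, h2⟩, h3⟩, h4⟩, h5⟩, h6⟩, h7⟩, h8⟩, h9⟩ := hP
  obtain ⟨e0, e1, e2, e3, e4, e5, e6, e7, e8, e9⟩ := h
  constructor
  · rw [hu.ireg _ h0, e0]
  · rw [hu.ireg _ h1, e1]
  · rw [hu.ireg _ h2, e2]
  · rw [hu.ireg _ h3, e3]
  · rw [hu.rreg _ h4, e4]
  · rw [hu.rreg _ h5, e5]
  · rw [hu.rarr _ h6]; exact e6
  · rw [hu.rarr _ h7]; exact e7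
  · rw [hu.rarr _ h8]; exact e8
  · rw [hu.rarr _ h9]; exact e9

end HasInput

variable {n m : ℕ} [NeZero m] {I : Setting n m} {t : Fin m → ℝ} {G : ℝ → Prop} {s : Memory}

/-- As in the later specifications, the numeric constants bound `Prog.cost` and `Prog.ariths` of
loop-free pieces and are checked by `decide`. -/
theorem spec_gains (hG : GoodNumbers I t G) (hs : HasInput I t s) (h4 : s.ireg 4 = 0) :
    Spec G gains (m * 15 + 1) (m * 1) s fun s' =>
      ∀ j < m, s'.rarr 4 j = I.gain t j ∧ s'.rarr 5 j = I.gain t j := by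
  refine (Spec.loop (T := 14) (A := 1) m (fun k s' => s'.ireg 4 = k ∧
    ∀ j < k, s'.rarr 4 j = I.gain t j ∧ s'.rarr 5 j = I.gain t j) ⟨h4, by simp⟩ ?_ ?_).conseq
    (fun _ _ h => h.2) le_rfl le_rfl
  · rintro k hk s' hu ⟨h, hj⟩
    have hs' := hs.unchanged hu rfl
    have e : s'.rarr 1 k - s'.rarr 0 k = I.gain t k := by
      rw [hs'.reward k hk, hs'.payment k hk, Setting.gain]
    refine ⟨by simp [Test.Holds, h, hs'.ireg_one, hk], (Spec.of_wp ?_).conseq (fun _ _ h => h)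
      (by decide) (by decide)⟩
    simp [gainBody, block, wp, Instr.Creates, Instr.exec, Arith.eval, h, hs'.ireg_two, e,
      hG.gain k hk]
    intro j hjk
    rcases hjk.lt_or_eq with hjk | rfl
    · simp [hjk.ne, hj j hjk]
    · simp
  · rintro s' hu ⟨h, -⟩
    have hs' := hs.unchanged hu rfl
    simp [Test.Holds, h, hs'.ireg_one]

theorem upperSum_succ (f : ℕ → ℝ) (j k : ℕ) : I.upperSum t f j (k + 1) =
    I.upperSum t f j k + if I.payoff t k < I.payoff t j then 0 else f k :=
  Finset.sum_range_succ _ _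

theorem spec_uppers (hG : GoodNumbers I t G) (hs : HasInput I t s)
    (hg : ∀ j < m, s.rarr 4 j = I.gain t j) {i j : ℕ} (hi : i < n) (hj : j < m)
    (h1 : toLex (s.rreg 1, s.rreg 2) = I.payoff t j) (h3 : s.rreg 3 = -extendZero I.cost i)
    (h4 : s.rreg 4 = 0) (h5 : s.rreg 5 = 0) (h9 : s.ireg 9 = 0) (h10 : s.ireg 10 = i * m) :
    Spec G uppers (m * 29 + 1) (m * 5) s fun s' =>
      s'.rreg 3 = -extendZero I.cost i +
        I.upperSum t (fun a => I.probAt i a * extendZero t a) j m ∧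
      s'.rreg 4 = I.upperSum t (fun a => I.probAt i a * I.gain t a) j m ∧
      s'.rreg 5 = I.upperSum t (I.probAt i) j m := by
  refine (Spec.loop (T := 28) (A := 5) m (fun k s' => s'.ireg 9 = k ∧ s'.ireg 10 = i * m + k ∧
      s'.rreg 3 = -extendZero I.cost i +
        I.upperSum t (fun a => I.probAt i a * extendZero t a) j k ∧
      s'.rreg 4 = I.upperSum t (fun a => I.probAt i a * I.gain t a) j k ∧
      s'.rreg 5 = I.upperSum t (I.probAt i) j k)
    (by simp [h9, h10, h3, h4, h5, Setting.upperSum]) ?_ ?_).conseq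
    (fun _ _ h => h.2.2) le_rfl le_rfl
  · rintro k hk s' hu ⟨e9, e10, e3, e4, e5⟩
    have hs' := hs.unchanged hu rfl
    have et := hs'.payment k hk
    have eg : s'.rarr 4 k = I.gain t k := by rw [hu.rarr 4 rfl, hg k hk]
    have ep := hs'.prob i hi k hk
    have e1 : toLex (s'.rreg 1, s'.rreg 2) = I.payoff t j := by
      rw [hu.rreg 1 rfl, hu.rreg 2 rfl, h1]
    have ek : toLex (extendZero t k, I.gain t k) = I.payoff t k := rfl
    refine ⟨by simp [Test.Holds, e9, hs'.ireg_one, hk], (Spec.of_wp ?_).conseq (fun _ _ h => h)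
      (by decide) (by decide)⟩
    have g1 := hG.upperSum_payment i hi j hj (k + 1) hk
    have g2 := hG.upperSum_gain i hi j hj (k + 1) hk
    have g3 := hG.upperSum_prob i hi j hj (k + 1) hk
    rw [upperSum_succ] at g1 g2 g3
    simp only [upperSum_succ]
    simp [upperBody, block, wp, wp_lexLt, Instr.Creates, Instr.exec, Arith.eval, hs'.ireg_two,
      e9, e10, e3, e4, e5, et, eg, ep, e1, ek]
    constructor
    · intro h
      simp [h, add_assoc]
    · intro h
      have h := not_lt.2 h
      simp only [h, if_false] at g1 g2 g3 ⊢
      simp [add_assoc, hG.prob_mul_payment i hi k hk, hG.prob_mul_gain i hi k hk, g1, g2, g3]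
  · rintro s' hu ⟨h, -⟩
    have hs' := hs.unchanged hu rfl
    simp [Test.Holds, h, hs'.ireg_one]

theorem spec_quotients (hG : GoodNumbers I t G) (hs : HasInput I t s)
    (hg : ∀ j < m, s.rarr 4 j = I.gain t j) {i : ℕ} (hi : i < n) (h8 : s.ireg 8 = 0)
    (h6 : s.ireg 6 = i * m) (h10 : s.rreg 10 = -extendZero I.cost i)
    (h11 : toLex (s.rreg 11, s.rreg 12) = I.maxQuotient t i 0) :
    Spec G quotients (m * (m * 29 + 51) + 1) (m * (m * 5 + 2)) s fun s' =>
      toLex (s'.rreg 11, s'.rreg 12) = I.reservation t i := by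
  refine (Spec.loop (T := m * 29 + 50) (A := m * 5 + 2) m (fun k s' => s'.ireg 8 = k ∧
      toLex (s'.rreg 11, s'.rreg 12) = I.maxQuotient t i k) ⟨h8, h11⟩ ?_ ?_).conseq
    (fun _ _ h => h.2) le_rfl le_rfl
  · rintro k hk s₁ hu₁ ⟨e8, e11⟩
    have hs₁ := hs.unchanged hu₁ rfl
    have eg : ∀ j < m, s₁.rarr 4 j = I.gain t j := by rwa [hu₁.rarr 4 rfl]
    have e6 : s₁.ireg 6 = i * m := by rw [hu₁.ireg 6 rfl, h6]
    have e10 : s₁.rreg 10 = -extendZero I.cost i := by rw [hu₁.rreg 10 rfl, h10]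
    refine ⟨by simp [Test.Holds, e8, hs₁.ireg_one, hk], ?_⟩
    refine Spec.seq (R := fun s' => toLex (s'.rreg 1, s'.rreg 2) = I.payoff t k ∧
      s'.rreg 3 = -extendZero I.cost i ∧ s'.rreg 4 = 0 ∧ s'.rreg 5 = 0 ∧ s'.ireg 9 = 0 ∧
      s'.ireg 10 = i * m) (T₁ := 15) (T₂ := m * 29 + 34) (A₁ := 0) (A₂ := m * 5 + 2)
      ((Spec.of_wp ?_).conseq (fun _ _ h => h) (by decide) (by decide)) ?_ (by omega) (by omega)
    · simp [quotientInit, block, wp, Instr.Creates, Instr.exec, e8, e6, e10, hs₁.rreg_zero,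
        hs₁.payment k hk, eg k hk]
      rfl
    rintro s₂ hu₂ ⟨f1, f3, f4, f5, f9, f10⟩
    have hs₂ := hs₁.unchanged hu₂ rfl
    refine Spec.seq (spec_uppers hG hs₂ (by rwa [hu₂.rarr 4 rfl]) hi hk f1 f3 f4 f5 f9 f10)
      (T₂ := 28) (A₂ := 2) ?_ (by omega) (by omega)
    rintro s₃ hu₃ ⟨g3, g4, g5⟩
    have hs₃ := hs₂.unchanged hu₃ rfl
    have g8 : s₃.ireg 8 = k := by rw [hu₃.ireg 8 rfl, hu₂.ireg 8 rfl, e8]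
    have g11 : toLex (s₃.rreg 11, s₃.rreg 12) = I.maxQuotient t i k := by
      rw [hu₃.rreg 11 rfl, hu₂.rreg 11 rfl, hu₃.rreg 12 rfl, hu₂.rreg 12 rfl, e11]
    refine (Spec.of_wp ?_).conseq (fun _ _ h => h) (by decide) (by decide)
    have eq : toLex ((-extendZero I.cost i +
        I.upperSum t (fun a => I.probAt i a * extendZero t a) k m) /
        I.upperSum t (I.probAt i) k m, I.upperSum t (fun a => I.probAt i a * I.gain t a) k m /
        I.upperSum t (I.probAt i) k m) = I.quotient t i k := rfl
    have hq := hG.quotient i hi k hk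
    simp only [Setting.quotient, ofLex_toLex] at hq
    simp [quotientFinish, block, wp, wp_lexLt, Test.Holds, Instr.Creates, Instr.exec, Arith.eval,
      hs₃.ireg_two, hs₃.rreg_zero, g3, g4, g5, g8, g11, eq, Setting.maxQuotient]
    refine ⟨fun h0 => ⟨(hq h0).1, (hq h0).2, fun h => ?_, fun h => ?_⟩, fun h0 => ?_⟩
    · simp [h0, h]
    · simp [not_lt.2 h]
    · simp [not_lt.2 h0]
  · rintro s' hu ⟨h, -⟩
    have hs' := hs.unchanged hu rfl
    simp [Test.Holds, h, hs'.ireg_one]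

/-- The result of the preprocessing of the actions. -/
structure HasReservations (I : Setting n m) (t : Fin m → ℝ) (s : Memory) : Prop where
  gain : ∀ j < m, s.rarr 4 j = I.gain t j
  reservation : ∀ i < n, toLex (s.rarr 6 i, s.rarr 7 i) = I.reservation t i
  offset : ∀ i < n, s.iarr 0 i = i * m

theorem spec_reservations (hG : GoodNumbers I t G) (hs : HasInput I t s)
    (hg : ∀ j < m, s.rarr 4 j = I.gain t j) (h5 : s.ireg 5 = 0) (h6 : s.ireg 6 = 0)
    (h7 : s.ireg 7 = n) :
    Spec G reservations (n * (m * (m * 29 + 51) + 41) + 1) (n * (m * (m * 5 + 2) + 2)) s fun s' =>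
      HasReservations I t s' ∧ ∀ i < n, s'.iarr 1 (n + i) = i := by
  refine (Spec.loop (T := m * (m * 29 + 51) + 40) (A := m * (m * 5 + 2) + 2) n (fun k s' =>
      s'.ireg 5 = k ∧ s'.ireg 6 = k * m ∧ s'.ireg 7 = n + k ∧
      ∀ i < k, toLex (s'.rarr 6 i, s'.rarr 7 i) = I.reservation t i ∧ s'.iarr 0 i = i * m ∧
        s'.iarr 1 (n + i) = i)
    ⟨h5, by simpa using h6, h7, by simp⟩ ?_ ?_).conseq (fun s' hu h => ⟨⟨?_, ?_, ?_⟩, ?_⟩)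
    le_rfl le_rfl
  · rintro k hk s₁ hu₁ ⟨e5, e6, e7, ei⟩
    have hs₁ := hs.unchanged hu₁ rfl
    have eg : ∀ j < m, s₁.rarr 4 j = I.gain t j := by rwa [hu₁.rarr 4 rfl]
    refine ⟨by simp [Test.Holds, e5, hs₁.ireg_zero, hk], ?_⟩
    refine Spec.seq (R := fun s' => s'.rreg 10 = -extendZero I.cost k ∧
      toLex (s'.rreg 11, s'.rreg 12) = I.maxQuotient t k 0 ∧ s'.ireg 8 = 0)
      (T₁ := 11) (T₂ := m * (m * 29 + 51) + 28) (A₁ := 2) (A₂ := m * (m * 5 + 2))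
      ((Spec.of_wp ?_).conseq (fun _ _ h => h) (by decide) (by decide)) ?_ (by omega) (by omega)
    · simp [reservationInit, block, wp, Instr.Creates, Instr.exec, Arith.eval, e5,
        hs₁.rreg_zero, hs₁.rreg_one, hs₁.cost k hk, hG.neg_cost k hk, hG.neg_cost_sub_one k hk,
        Setting.maxQuotient]
    rintro s₂ hu₂ ⟨f10, f11, f8⟩
    have hs₂ := hs₁.unchanged hu₂ rfl
    have f6 : s₂.ireg 6 = k * m := by rw [hu₂.ireg 6 rfl, e6]
    refine Spec.seq (spec_quotients hG hs₂ (by rwa [hu₂.rarr 4 rfl]) hk f8 f6 f10 f11)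
      (T₂ := 24) (A₂ := 0) ?_ (by omega) (by omega)
    rintro s₃ hu₃ g11
    have hs₃ := hs₂.unchanged hu₃ rfl
    have g5 : s₃.ireg 5 = k := by rw [hu₃.ireg 5 rfl, hu₂.ireg 5 rfl, e5]
    have g6 : s₃.ireg 6 = k * m := by rw [hu₃.ireg 6 rfl, f6]
    have g7 : s₃.ireg 7 = n + k := by rw [hu₃.ireg 7 rfl, hu₂.ireg 7 rfl, e7]
    have gi : ∀ i < k, toLex (s₃.rarr 6 i, s₃.rarr 7 i) = I.reservation t i ∧
        s₃.iarr 0 i = i * m ∧ s₃.iarr 1 (n + i) = i := by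
      rw [hu₃.rarr 6 rfl, hu₃.rarr 7 rfl, hu₃.iarr 0 rfl, hu₃.iarr 1 rfl, hu₂.rarr 6 rfl,
        hu₂.rarr 7 rfl, hu₂.iarr 0 rfl, hu₂.iarr 1 rfl]
      exact ei
    refine (Spec.of_wp ?_).conseq (fun _ _ h => h) (by decide) (by decide)
    simp [reservationFinish, block, wp, Instr.Creates, Instr.exec, g5, g6, g7, hs₃.ireg_two,
      hs₃.ireg_one, Nat.succ_mul, add_assoc]
    intro i hi
    rcases hi.lt_or_eq with hi | rfl
    · simp [hi.ne, gi i hi]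
    · simp [g11]
  · rintro s' hu ⟨h, -⟩
    have hs' := hs.unchanged hu rfl
    simp [Test.Holds, h, hs'.ireg_zero]
  · rwa [hu.rarr 4 rfl]
  · exact fun i hi => (h.2.2.2 i hi).1
  · exact fun i hi => (h.2.2.2 i hi).2.1
  · exact fun i hi => (h.2.2.2 i hi).2.2

/-! ### The tournament -/

/-- The winner of two candidates; `n` stands for no candidate. -/
noncomputable def winner (n : ℕ) (z : ℕ → ℝ ×ₗ ℝ) (a b : ℕ) : ℕ :=
  if a < n then if b < n then if z b < z a then b else a else a else b

/-- The inner node `k` holds the winner of its children. -/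
def IsWinner (n : ℕ) (z : ℕ → ℝ ×ₗ ℝ) (win : ℕ → ℕ) (k : ℕ) : Prop :=
  win k = winner n z (win (k + k)) (win (k + k + 1))

theorem winner_lt_and_le {n : ℕ} {z : ℕ → ℝ ×ₗ ℝ} {a b c : ℕ} (hc : c = a ∨ c = b) (h : c < n) :
    winner n z a b < n ∧ z (winner n z a b) ≤ z c := by
  rw [winner]
  rcases hc with rfl | rfl
  · rw [if_pos h]
    split_ifs with h1 h2
    · exact ⟨h1, h2.le⟩
    · exact ⟨h, le_rfl⟩
    · exact ⟨h, le_rfl⟩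
  · split_ifs with h1 h2
    · exact ⟨h, le_rfl⟩
    · exact ⟨h1, not_lt.1 h2⟩
    · exact ⟨h, le_rfl⟩

theorem winner_eq (n : ℕ) (z : ℕ → ℝ ×ₗ ℝ) (a b : ℕ) : winner n z a b = a ∨ winner n z a b = b := by
  rw [winner]
  split_ifs <;> simp

/-- The root of a tournament on the leaves `n, …, 2n - 1` is minimal. -/
theorem root_lt_and_le {n : ℕ} {z : ℕ → ℝ ×ₗ ℝ} {win : ℕ → ℕ}
    (h : ∀ k, 1 ≤ k → k < n → IsWinner n z win k) {x : ℕ} (h1 : 1 ≤ x) (h2 : x < 2 * n)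
    (hx : win x < n) : win 1 < n ∧ z (win 1) ≤ z (win x) := by
  induction x using Nat.strong_induction_on with
  | _ x ih =>
    rcases h1.lt_or_eq with h1 | rfl
    · have hk := h (x / 2) (by omega) (by omega)
      rw [IsWinner] at hk
      have hc : win x = win (x / 2 + x / 2) ∨ win x = win (x / 2 + x / 2 + 1) := by
        rcases Nat.even_or_odd' x with ⟨y, rfl | rfl⟩
        · left; congr 1; omega
        · right; congr 1; omega
      obtain ⟨h3, h4⟩ := winner_lt_and_le hc hx
      rw [← hk] at h3 h4
      obtain ⟨h5, h6⟩ := ih (x / 2) (by omega) (by omega) (by omega) h3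
      exact ⟨h5, h6.trans h4⟩
    · exact ⟨hx, le_rfl⟩

/-- Every node holds an entry of a leaf. -/
theorem exists_leaf {n : ℕ} {z : ℕ → ℝ ×ₗ ℝ} {win : ℕ → ℕ}
    (h : ∀ k, 1 ≤ k → k < n → IsWinner n z win k) {x : ℕ} (h1 : 1 ≤ x) (h2 : x < 2 * n) :
    ∃ i < n, win x = win (n + i) := by
  -- Children have larger indices than their parent, so the distance to `2 * n` decreases.
  induction hy : 2 * n - x using Nat.strong_induction_on generalizing x with
  | _ y ih =>
    by_cases hx : x < n
    · have hk := h x h1 hx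
      rw [IsWinner] at hk
      rcases winner_eq n z (win (x + x)) (win (x + x + 1)) with h' | h'
      · rw [hk, h']
        exact ih _ (by omega) (by omega) (by omega) rfl
      · rw [hk, h']
        exact ih _ (by omega) (by omega) (by omega) rfl
    · exact ⟨x - n, by omega, by congr 1; omega⟩

/-- After recomputing a node, at most its parent is wrong. -/
theorem isWinner_update {n : ℕ} {z : ℕ → ℝ ×ₗ ℝ} {win : ℕ → ℕ} {x k : ℕ}
    (hk : k ≠ x → IsWinner n z win k) (hkx : k ≠ x / 2) :
    IsWinner n z
      (Function.update win x (winner n z (win (x + x)) (win (x + x + 1)))) k := by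
  -- If a child of `k` were `x`, then `k` would be `x / 2`; hence the update can only touch `k`
  -- itself.
  rw [IsWinner, Function.update_apply, Function.update_of_ne (show k + k ≠ x by omega),
    Function.update_of_ne (show k + k + 1 ≠ x by omega)]
  split_ifs with h
  · rw [h]
  · exact hk h

/-- The effect of recomputing the node in register `r`. -/
theorem spec_node {r : ℕ} (hs : HasInput I t s) (hz : HasReservations I t s)
    (hr : r = 11 ∨ r = 20) :
    Spec G (node r) 30 0 s fun s' =>
      s'.ireg 12 = s.ireg r + s.ireg r ∧ s'.ireg 13 = s.ireg r + s.ireg r + 1 ∧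
      s'.iarr 1 = Function.update (s.iarr 1) (s.ireg r) (winner n (I.reservation t)
        (s.iarr 1 (s.ireg r + s.ireg r)) (s.iarr 1 (s.ireg r + s.ireg r + 1))) := by
  have key : (node r).wp G (fun s' => s'.ireg 12 = s.ireg r + s.ireg r ∧
      s'.ireg 13 = s.ireg r + s.ireg r + 1 ∧
      s'.iarr 1 = Function.update (s.iarr 1) (s.ireg r) (winner n (I.reservation t)
        (s.iarr 1 (s.ireg r + s.ireg r)) (s.iarr 1 (s.ireg r + s.ireg r + 1)))) s := by
    -- `node` writes the integer registers `12` to `16`, so the node index must live elsewhere.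
    have hr' : r ≠ 12 ∧ r ≠ 13 ∧ r ≠ 14 ∧ r ≠ 15 ∧ r ≠ 16 := by omega
    simp [node, block, wp, wp_lexLt, Test.Holds, Instr.Creates, Instr.exec, hs.ireg_two,
      hs.ireg_zero, hr']
    generalize s.iarr 1 (s.ireg r + s.ireg r) = a
    generalize s.iarr 1 (s.ireg r + s.ireg r + 1) = b
    refine ⟨fun ha => ⟨fun hb => ?_, fun hb => ?_⟩, fun ha => ?_⟩
    · rw [hz.reservation a ha, hz.reservation b hb]
      refine ⟨fun h => ?_, fun h => ?_⟩
      · simp [winner, ha, hb, h]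
      · simp [winner, ha, hb, not_lt.2 h]
    · simp [winner, ha, not_lt.2 hb]
    · simp [winner, not_lt.2 ha]
  rcases hr with rfl | rfl
  · exact (Spec.of_wp key).conseq (fun _ _ h => h) (by decide) (by decide)
  · exact (Spec.of_wp key).conseq (fun _ _ h => h) (by decide) (by decide)

/-- The memory holds a tournament of the actions that are not in the list. -/
structure HasTournament (I : Setting n m) (t : Fin m → ℝ) (s : Memory) (l : List (Fin n)) :
    Prop where
  leaf : ∀ i : Fin n, s.iarr 1 (n + i) = if i ∈ l then n else i
  inner : ∀ k, 1 ≤ k → k < n → IsWinner n (I.reservation t) (s.iarr 1) k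
  parent : ∀ x, 2 ≤ x → x < 2 * n → s.iarr 2 x = x / 2

theorem HasReservations.unchanged {P : Prog} {s s' : Memory} (h : HasReservations I t s)
    (hu : Unchanged P s s') (h4 : P.any (Instr.writesRarr 4) = false)
    (h6 : P.any (Instr.writesRarr 6) = false) (h7 : P.any (Instr.writesRarr 7) = false)
    (h0 : P.any (Instr.writesIarr 0) = false) : HasReservations I t s' := by
  constructor
  · rw [hu.rarr 4 h4]
    exact h.gain
  · rw [hu.rarr 6 h6, hu.rarr 7 h7]
    exact h.reservation
  · rw [hu.iarr 0 h0]
    exact h.offset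

/-- Nodes are filled from `n - 1` down to `1`: overwriting a node can only spoil its parent, which
has not been built yet. -/
theorem spec_build (hn : 0 < n) (hs : HasInput I t s) (hz : HasReservations I t s)
    (hl : ∀ i < n, s.iarr 1 (n + i) = i) (h11 : s.ireg 11 = n) :
    Spec G build (n * 41 + 1) 0 s fun s' => HasTournament I t s' [] := by
  refine (Spec.loop (T := 40) (A := 0) (n - 1) (fun k s' => s'.ireg 11 = n - k ∧
      (∀ i < n, s'.iarr 1 (n + i) = i) ∧
      (∀ j, n - k ≤ j → j < n → IsWinner n (I.reservation t) (s'.iarr 1) j) ∧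
      ∀ x, 2 * (n - k) ≤ x → x < 2 * n → s'.iarr 2 x = x / 2)
    ⟨h11, hl, fun j h1 h2 => by omega, fun j h1 h2 => by omega⟩ ?_ ?_).conseq
    (fun s' hu h => ⟨?_, ?_, ?_⟩) ?_ (by simp)
  · rintro k hk s₁ hu₁ ⟨e11, ei, ej, ex⟩
    have hs₁ := hs.unchanged hu₁ rfl
    have hz₁ := hz.unchanged hu₁ rfl rfl rfl rfl
    refine ⟨by simp [Test.Holds, e11, hs₁.ireg_two]; omega, ?_⟩
    obtain ⟨y, hy⟩ : ∃ y, n - k = y + 1 := ⟨n - k - 1, by omega⟩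
    have hy' : n - (k + 1) = y := by omega
    rw [hy] at e11 ej ex
    refine Spec.seq (R := fun s' => s'.ireg 11 = y) (T₁ := 1) (T₂ := 38) (A₁ := 0) (A₂ := 0)
      ((Spec.of_wp ?_).conseq (fun _ _ h => h) (by decide) (by decide)) ?_ (by omega) (by omega)
    · simp [wp, Instr.Creates, Instr.exec, e11, hs₁.ireg_two]
    intro s₂ hu₂ f11
    have hs₂ := hs₁.unchanged hu₂ rfl
    have hz₂ := hz₁.unchanged hu₂ rfl rfl rfl rfl
    refine Spec.seq (spec_node hs₂ hz₂ (Or.inl rfl)) (T₂ := 7) (A₂ := 0) ?_ (by omega) (by omega)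
    rw [f11, hu₂.iarr 1 rfl]
    rintro s₃ hu₃ ⟨g12, g13, g1⟩
    refine (Spec.of_wp ?_).conseq (fun _ _ h => h) (by decide) (by decide)
    have g11 : s₃.ireg 11 = y := by rw [hu₃.ireg 11 rfl, f11]
    have g2 : s₃.iarr 2 = s₁.iarr 2 := by rw [hu₃.iarr 2 rfl, hu₂.iarr 2 rfl]
    simp only [block, wp, Instr.Creates, Instr.exec, true_and]
    rw [hy']
    refine ⟨g11, ?_, ?_, ?_⟩
    · intro i hi
      simp only [Function.update_of_ne (show (1 : ℕ) ≠ 2 by decide), g1]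
      rw [Function.update_of_ne (by omega), ei i hi]
    · intro j h1 h2
      simp only [Function.update_of_ne (show (1 : ℕ) ≠ 2 by decide), g1]
      exact isWinner_update (fun h => ej j (by omega) h2) (by omega)
    · intro x h1 h2
      simp only [Function.update_self, g12, g13, g11, g2, Function.update_apply]
      split_ifs with h3 h4
      · omega
      · omega
      · exact ex x (by omega) h2
  · rintro s' hu ⟨h, -⟩
    have hs' := hs.unchanged hu rfl
    simp [Test.Holds, h, hs'.ireg_two]
    omega
  · intro i
    simpa using h.2.1 i i.2
  · exact fun k h1 h2 => h.2.2.1 k (by omega) h2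
  · exact fun x h1 h2 => h.2.2.2 x (by omega) h2
  · have := Nat.mul_le_mul_right 41 (Nat.sub_le n 1)
    omega

/-- Climbing keeps a single possibly wrong node, the parent of the current one. After `Nat.log 2 x`
rounds the current node is the root `1`, whose parent index `0` is not an inner node. -/
theorem spec_path (hs : HasInput I t s) (hz : HasReservations I t s) {x : ℕ} (h1 : 1 ≤ x)
    (h2 : x < 2 * n) (h20 : s.ireg 20 = x) {l : List (Fin n)}
    (hl : ∀ i : Fin n, s.iarr 1 (n + i) = if i ∈ l then n else i)
    (hw : ∀ k, 1 ≤ k → k < n → k ≠ x / 2 → IsWinner n (I.reservation t) (s.iarr 1) k)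
    (hp : ∀ x, 2 ≤ x → x < 2 * n → s.iarr 2 x = x / 2) :
    Spec G path ((Nat.log 2 n + 1) * 36 + 1) 0 s fun s' => HasTournament I t s' l := by
  refine (Spec.loop (T := 35) (A := 0) (Nat.log 2 x) (fun k s' => s'.ireg 20 = x / 2 ^ k ∧
      (∀ i : Fin n, s'.iarr 1 (n + i) = if i ∈ l then n else i) ∧
      ∀ j, 1 ≤ j → j < n → j ≠ x / 2 ^ k / 2 → IsWinner n (I.reservation t) (s'.iarr 1) j)
    ⟨by simpa using h20, hl, by simpa using hw⟩ ?_ ?_).conseq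
    (fun s' hu h => ⟨h.2.1, ?_, ?_⟩) ?_ (by simp)
  · rintro k hk s₁ hu₁ ⟨e20, ei, ej⟩
    have hs₁ := hs.unchanged hu₁ rfl
    have hz₁ := hz.unchanged hu₁ rfl rfl rfl rfl
    have hx2 : 2 ≤ x / 2 ^ k := by
      rw [Nat.le_div_iff_mul_le (by positivity), ← pow_succ']
      exact (Nat.pow_le_pow_right (by omega) hk).trans (Nat.pow_log_le_self 2 (by omega))
    have hx3 : x / 2 ^ k ≤ x := Nat.div_le_self _ _
    refine ⟨by simp only [Test.Holds, e20, hs₁.ireg_two]; omega, ?_⟩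
    rw [pow_succ, ← Nat.div_div_eq_div_mul]
    generalize x / 2 ^ k = y at *
    refine Spec.seq (R := fun s' => s'.ireg 20 = y / 2) (T₁ := 1) (T₂ := 33) (A₁ := 0)
      (A₂ := 0) ((Spec.of_wp ?_).conseq (fun _ _ h => h) (by decide) (by decide)) ?_ (by omega)
      (by omega)
    · simp [wp, Instr.Creates, Instr.exec, e20, hu₁.iarr 2 rfl, hp y hx2 (by omega)]
    intro s₂ hu₂ f20
    have hs₂ := hs₁.unchanged hu₂ rfl
    have hz₂ := hz₁.unchanged hu₂ rfl rfl rfl rfl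
    refine Spec.seq (spec_node hs₂ hz₂ (Or.inr rfl)) (T₂ := 1) (A₂ := 0) ?_ (by omega) (by omega)
    rw [f20, hu₂.iarr 1 rfl]
    rintro s₃ hu₃ ⟨-, -, g1⟩
    refine Spec.skip ⟨by rw [hu₃.ireg 20 rfl, f20], ?_, ?_⟩
    · intro i
      rw [g1, Function.update_of_ne (by omega), ei]
    · intro j h3 h4 h5
      rw [g1]
      exact isWinner_update (fun h => ej j h3 h4 h) h5
  · rintro s' hu ⟨h, -⟩
    have hs' := hs.unchanged hu rfl
    have : x / 2 ^ Nat.log 2 x < 2 := by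
      rw [Nat.div_lt_iff_lt_mul (by positivity), ← pow_succ']
      exact Nat.lt_pow_succ_log_self (by omega) x
    simp only [Test.Holds, h, hs'.ireg_two]
    omega
  · intro k h3 h4
    refine h.2.2 k h3 h4 ?_
    have : x / 2 ^ Nat.log 2 x < 2 := by
      rw [Nat.div_lt_iff_lt_mul (by positivity), ← pow_succ']
      exact Nat.lt_pow_succ_log_self (by omega) x
    omega
  · rw [hu.iarr 2 rfl]
    exact hp
  -- Leaf indices lie below `2 * n`, which costs at most one level more than `Nat.log 2 n`.
  · have : Nat.log 2 x ≤ Nat.log 2 n + 1 := by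
      rw [← Nat.log_mul_base (by omega) (by omega)]
      exact Nat.log_mono_right (by omega)
    have := Nat.mul_le_mul_right 36 this
    omega

/-! ### The backward recursion -/

theorem spec_sums (hG : GoodNumbers I t G) (hs : HasInput I t s) (hz : HasReservations I t s)
    {l : List (Fin n)} (hl : l.Nodup) (hv : ∀ a < m, s.rarr 5 a = I.value t l a) {i j : ℕ}
    (hi : i < n) (hj : j < m) (h1 : toLex (s.rreg 1, s.rreg 2) = I.payoff t j)
    (h3 : s.rreg 3 = I.value t l j) (h4 : s.rreg 4 = 0) (h9 : s.ireg 9 = 0)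
    (h10 : s.ireg 10 = i * m) :
    Spec G sums (m * 26 + 1) (m * 2) s fun s' => s'.rreg 4 =
      ∑ a ∈ Finset.range m, I.probAt i a * I.value t l (I.better t j a) := by
  refine (Spec.loop (T := 25) (A := 2) m (fun k s' => s'.ireg 9 = k ∧ s'.ireg 10 = i * m + k ∧
      s'.rreg 4 = ∑ a ∈ Finset.range k, I.probAt i a * I.value t l (I.better t j a))
    (by simp [h9, h10, h4]) ?_ ?_).conseq (fun _ _ h => h.2.2) le_rfl le_rfl
  · rintro k hk s' hu ⟨e9, e10, e4⟩
    have hs' := hs.unchanged hu rfl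
    have et := hs'.payment k hk
    have eg : s'.rarr 4 k = I.gain t k := by rw [hu.rarr 4 rfl, hz.gain k hk]
    have ev : s'.rarr 5 k = I.value t l k := by rw [hu.rarr 5 rfl, hv k hk]
    have ep := hs'.prob i hi k hk
    have e1 : toLex (s'.rreg 1, s'.rreg 2) = I.payoff t j := by
      rw [hu.rreg 1 rfl, hu.rreg 2 rfl, h1]
    have e3 : s'.rreg 3 = I.value t l j := by rw [hu.rreg 3 rfl, h3]
    have ek : toLex (extendZero t k, I.gain t k) = I.payoff t k := rfl
    refine ⟨by simp [Test.Holds, e9, hs'.ireg_one, hk], (Spec.of_wp ?_).conseq (fun _ _ h => h)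
      (by decide) (by decide)⟩
    have g := hG.sum_value l hl i hi j hj (k + 1) hk
    rw [Finset.sum_range_succ] at g
    have gk := hG.prob_mul_value l hl i hi k hk k hk
    have gj := hG.prob_mul_value l hl i hi k hk j hj
    simp only [Finset.sum_range_succ]
    rw [Setting.better] at g ⊢
    simp [sumBody, block, wp, wp_lexLt, Instr.Creates, Instr.exec, Arith.eval, hs'.ireg_two,
      e9, e10, e3, e4, et, eg, ev, ep, e1, ek]
    constructor
    · intro h
      simp only [h, if_true] at g ⊢
      simp [add_assoc, g, gk]
    · intro h
      simp only [not_lt.2 h, if_false] at g ⊢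
      simp [add_assoc, g, gj]
  · rintro s' hu ⟨h, -⟩
    have hs' := hs.unchanged hu rfl
    simp [Test.Holds, h, hs'.ireg_one]

theorem spec_values (hG : GoodNumbers I t G) (hs : HasInput I t s) (hz : HasReservations I t s)
    {l : List (Fin n)} (hl : l.Nodup) (hv : ∀ a < m, s.rarr 5 a = I.value t l a) {i : Fin n}
    (h8 : s.ireg 8 = 0) (h19 : s.ireg 19 = i * m)
    (h14 : toLex (s.rreg 14, s.rreg 15) = I.reservation t i) :
    Spec G values (m * (m * 26 + 31) + 1) (m * (m * 2)) s fun s' =>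
      ∀ j < m, s'.rarr 8 j = I.value t (i :: l) j := by
  refine (Spec.loop (T := m * 26 + 30) (A := m * 2) m (fun k s' => s'.ireg 8 = k ∧
      ∀ j < k, s'.rarr 8 j = I.value t (i :: l) j) ⟨h8, by simp⟩ ?_ ?_).conseq
    (fun _ _ h => h.2) le_rfl le_rfl
  · rintro k hk s₁ hu₁ ⟨e8, ej⟩
    have hs₁ := hs.unchanged hu₁ rfl
    have hz₁ := hz.unchanged hu₁ rfl rfl rfl rfl
    have ev : ∀ a < m, s₁.rarr 5 a = I.value t l a := by rwa [hu₁.rarr 5 rfl]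
    refine ⟨by simp [Test.Holds, e8, hs₁.ireg_one, hk], ?_⟩
    refine Spec.seq (R := fun s' => toLex (s'.rreg 1, s'.rreg 2) = I.payoff t k ∧
      s'.rreg 2 = I.gain t k ∧ s'.rreg 3 = I.value t l k ∧ s'.rreg 4 = 0 ∧ s'.ireg 9 = 0 ∧
      s'.ireg 10 = i * m) (T₁ := 13) (T₂ := m * 26 + 16) (A₁ := 0) (A₂ := m * 2)
      ((Spec.of_wp ?_).conseq (fun _ _ h => h) (by decide) (by decide)) ?_ (by omega) (by omega)
    · simp [valueInit, block, wp, Instr.Creates, Instr.exec, e8, hu₁.ireg 19 rfl, h19,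
        hs₁.rreg_zero, hs₁.payment k hk, hz₁.gain k hk, ev k hk]
      rfl
    rintro s₂ hu₂ ⟨f1, f2, f3, f4, f9, f10⟩
    have hs₂ := hs₁.unchanged hu₂ rfl
    have hz₂ := hz₁.unchanged hu₂ rfl rfl rfl rfl
    refine Spec.seq (spec_sums hG hs₂ hz₂ hl (by rwa [hu₂.rarr 5 rfl]) i.2 hk f1 f3 f4 f9 f10)
      (T₂ := 14) (A₂ := 0) ?_ (by omega) (by omega)
    rintro s₃ hu₃ g4
    have hs₃ := hs₂.unchanged hu₃ rfl
    have g8 : s₃.ireg 8 = k := by rw [hu₃.ireg 8 rfl, hu₂.ireg 8 rfl, e8]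
    have g1 : toLex (s₃.rreg 1, s₃.rreg 2) = I.payoff t k := by
      rw [hu₃.rreg 1 rfl, hu₃.rreg 2 rfl, f1]
    have g2 : s₃.rreg 2 = I.gain t k := by rw [hu₃.rreg 2 rfl, f2]
    have g14 : toLex (s₃.rreg 14, s₃.rreg 15) = I.reservation t i := by
      rw [hu₃.rreg 14 rfl, hu₃.rreg 15 rfl, hu₂.rreg 14 rfl, hu₂.rreg 15 rfl,
        hu₁.rreg 14 rfl, hu₁.rreg 15 rfl, h14]
    have gj : ∀ j < k, s₃.rarr 8 j = I.value t (i :: l) j := by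
      rw [hu₃.rarr 8 rfl, hu₂.rarr 8 rfl]
      exact ej
    refine (Spec.of_wp ?_).conseq (fun _ _ h => h) (by decide) (by decide)
    have hval : I.value t (i :: l) k = if I.payoff t k < I.reservation t i then
      ∑ a ∈ Finset.range m, I.probAt i a * I.value t l (I.better t k a) else I.gain t k := rfl
    simp [valueFinish, block, wp, wp_lexLt, Instr.Creates, Instr.exec, hs₃.ireg_two, g8, g1, g14]
    refine ⟨fun h j hj => ?_, fun h j hj => ?_⟩
    · rcases hj.lt_or_eq with hj | rfl
      · simp [hj.ne, gj j hj]
      · simp [g4, hval, h]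
    · rcases hj.lt_or_eq with hj | rfl
      · simp [hj.ne, gj j hj]
      · simp [g2, hval, not_lt.2 h]
  · rintro s' hu ⟨h, -⟩
    have hs' := hs.unchanged hu rfl
    simp [Test.Holds, h, hs'.ireg_one]

theorem spec_copy (hs : HasInput I t s) (h8 : s.ireg 8 = 0) :
    Spec G copy (m * 8 + 1) 0 s fun s' => ∀ j < m, s'.rarr 5 j = s.rarr 8 j := by
  refine (Spec.loop (T := 7) (A := 0) m (fun k s' => s'.ireg 8 = k ∧
    ∀ j < k, s'.rarr 5 j = s.rarr 8 j) ⟨h8, by simp⟩ ?_ ?_).conseq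
    (fun _ _ h => h.2) le_rfl (by simp)
  · rintro k hk s' hu ⟨h, hj⟩
    have hs' := hs.unchanged hu rfl
    refine ⟨by simp [Test.Holds, h, hs'.ireg_one, hk], (Spec.of_wp ?_).conseq (fun _ _ h => h)
      (by decide) (by decide)⟩
    simp [copyBody, block, wp, Instr.Creates, Instr.exec, h, hs'.ireg_two, hu.rarr 8 rfl]
    intro j hjk
    rcases hjk.lt_or_eq with hjk | rfl
    · simp [hjk.ne, hj j hjk]
    · simp
  · rintro s' hu ⟨h, -⟩
    have hs' := hs.unchanged hu rfl
    simp [Test.Holds, h, hs'.ireg_one]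

/-- The actions in the list are processed. -/
structure IsProcessed (I : Setting n m) (t : Fin m → ℝ) (s : Memory) (l : List (Fin n)) :
    Prop where
  nodup : l.Nodup
  sorted : l.Pairwise fun a b : Fin n => I.reservation t b ≤ I.reservation t a
  le : ∀ i ∉ l, ∀ b ∈ l, I.reservation t b ≤ I.reservation t i
  value : ∀ j < m, s.rarr 5 j = I.value t l j
  tournament : HasTournament I t s l

/-- An available leaf makes the root available and minimal. Conversely the root repeats the entry of
some leaf, and processed leaves hold `n`, so the root's action is unprocessed. -/
theorem IsProcessed.next {l : List (Fin n)} (h : IsProcessed I t s l) (hl : l.length < n) :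
    ∃ i : Fin n, s.iarr 1 1 = i ∧ i ∉ l ∧ ∀ k ∉ l, I.reservation t i ≤ I.reservation t k := by
  have hn : ∃ k, k ∉ l := by
    by_contra! hall
    have h1 : l.toFinset = Finset.univ := by
      ext k
      simp [hall]
    have h2 := List.toFinset_card_le l
    rw [h1, Finset.card_univ, Fintype.card_fin] at h2
    omega
  have hmin : ∀ k ∉ l, s.iarr 1 1 < n ∧
      I.reservation t (s.iarr 1 1) ≤ I.reservation t (k : Fin n) := by
    intro k hk
    have hk' := h.tournament.leaf k
    rw [if_neg hk] at hk'
    have := root_lt_and_le h.tournament.inner (x := n + k) (by omega) (by omega)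
      (by rw [hk']; exact k.2)
    rwa [hk'] at this
  obtain ⟨k, hk⟩ := hn
  have h1 := (hmin k hk).1
  refine ⟨⟨_, h1⟩, rfl, ?_, fun k hk => (hmin k hk).2⟩
  intro hmem
  obtain ⟨i, hi, hi'⟩ := exists_leaf h.tournament.inner (x := 1) le_rfl (by omega)
  have h2 := h.tournament.leaf ⟨i, hi⟩
  rw [← hi'] at h2
  split_ifs at h2 with h3
  · omega
  · refine h3 ?_
    convert hmem
    exact h2.symm

/-- The agent takes actions by decreasing reservation value, while the recursion runs backward from
the last one. Prepending the smallest remaining action therefore keeps the list in the agent's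
order. -/
theorem spec_extractBody (hG : GoodNumbers I t G) (hs : HasInput I t s)
    (hz : HasReservations I t s) {l : List (Fin n)} (h : IsProcessed I t s l)
    (hl : l.length < n) :
    Spec G extractBody (m * (m * 26 + 31) + m * 8 + (Nat.log 2 n + 1) * 36 + 40) (m * (m * 2)) s
      fun s' => s'.ireg 17 = s.ireg 17 + 1 ∧ ∃ i, IsProcessed I t s' (i :: l) := by
  obtain ⟨i, hi, hil, hmin⟩ := h.next hl
  refine Spec.seq (R := fun s' => s'.ireg 18 = i ∧ s'.ireg 19 = i * m ∧
      toLex (s'.rreg 14, s'.rreg 15) = I.reservation t i ∧ s'.ireg 8 = 0)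
    (T₁ := 11) (T₂ := m * (m * 26 + 31) + m * 8 + (Nat.log 2 n + 1) * 36 + 28) (A₁ := 0)
    ((Spec.of_wp ?_).conseq (fun _ _ h => h) (by decide) (by decide)) ?_ (by omega)
    (le_of_eq (zero_add _))
  · simp [extractInit, block, wp, Instr.Creates, Instr.exec, hs.ireg_two, hi,
      hz.offset i i.2, hz.reservation i i.2]
  rintro s₁ hu₁ ⟨e18, e19, e14, e8⟩
  have hs₁ := hs.unchanged hu₁ rfl
  have hz₁ := hz.unchanged hu₁ rfl rfl rfl rfl
  refine Spec.seq (spec_values hG hs₁ hz₁ h.nodup (by rw [hu₁.rarr 5 rfl]; exact h.value)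
    e8 e19 e14) (T₂ := m * 8 + (Nat.log 2 n + 1) * 36 + 26) (A₂ := 0) ?_ (by omega) le_rfl
  intro s₂ hu₂ f8
  have hs₂ := hs₁.unchanged hu₂ rfl
  have hz₂ := hz₁.unchanged hu₂ rfl rfl rfl rfl
  refine Spec.seq (R := fun s' => s'.ireg 8 = 0) (T₁ := 1)
    (T₂ := m * 8 + (Nat.log 2 n + 1) * 36 + 24) (A₁ := 0) (A₂ := 0)
    (Spec.of_wp ⟨trivial, by simp [Instr.exec]⟩) ?_ (by omega) le_rfl
  intro s₃ hu₃ g8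
  have hs₃ := hs₂.unchanged hu₃ rfl
  have hz₃ := hz₂.unchanged hu₃ rfl rfl rfl rfl
  refine Spec.seq (spec_copy hs₃ g8) (T₂ := (Nat.log 2 n + 1) * 36 + 22) (A₂ := 0) ?_ (by omega)
    le_rfl
  intro s₄ hu₄ g5
  rw [hu₃.rarr 8 rfl] at g5
  have hs₄ := hs₃.unchanged hu₄ rfl
  have hz₄ := hz₃.unchanged hu₄ rfl rfl rfl rfl
  have g18 : s₄.ireg 18 = i := by
    rw [hu₄.ireg 18 rfl, hu₃.ireg 18 rfl, hu₂.ireg 18 rfl, e18]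
  have g1 : s₄.iarr 1 = s.iarr 1 := by
    rw [hu₄.iarr 1 rfl, hu₃.iarr 1 rfl, hu₂.iarr 1 rfl, hu₁.iarr 1 rfl]
  refine Spec.seq (R := fun s' => s'.ireg 20 = n + i ∧
      s'.iarr 1 = Function.update (s.iarr 1) (n + i) n)
    (T₁ := 5) (T₂ := (Nat.log 2 n + 1) * 36 + 16) (A₁ := 0) (A₂ := 0)
    ((Spec.of_wp ?_).conseq (fun _ _ h => h) (by decide) (by decide)) ?_ (by omega) le_rfl
  · simp [removeLeaf, block, wp, Instr.Creates, Instr.exec, hs₄.ireg_zero, g18, g1]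
  rintro s₅ hu₅ ⟨h20, h1⟩
  have hs₅ := hs₄.unchanged hu₅ rfl
  have hz₅ := hz₄.unchanged hu₅ rfl rfl rfl rfl
  refine Spec.seq (spec_path hs₅ hz₅ (x := n + i) (l := i :: l) (by omega) (by omega) h20
    ?_ ?_ ?_) (T₂ := 1) (A₂ := 0) ?_ (by omega) le_rfl
  · intro k
    rw [h1, Function.update_apply, h.tournament.leaf]
    by_cases hk : k = i
    · simp [hk]
    · have : ¬ (n + (k : ℕ) = n + i) := fun h => hk (Fin.ext (by omega))
      rw [if_neg this]
      simp [hk]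
  -- Emptying the leaf `n + i` can only falsify its parent `(n + i) / 2`, which `h5` excludes.
  · intro k h3 h4 h5
    have := h.tournament.inner k h3 h4
    rw [IsWinner] at this ⊢
    rw [h1, Function.update_of_ne (by omega), Function.update_of_ne (by omega),
      Function.update_of_ne (by omega), this]
  · rw [hu₅.iarr 2 rfl, hu₄.iarr 2 rfl, hu₃.iarr 2 rfl, hu₂.iarr 2 rfl, hu₁.iarr 2 rfl]
    exact h.tournament.parent
  intro s₆ hu₆ ht
  have hs₆ := hs₅.unchanged hu₆ rfl
  have h17 : s₆.ireg 17 = s.ireg 17 := by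
    rw [hu₆.ireg 17 rfl, hu₅.ireg 17 rfl, hu₄.ireg 17 rfl, hu₃.ireg 17 rfl, hu₂.ireg 17 rfl,
      hu₁.ireg 17 rfl]
  refine Spec.of_wp ⟨trivial, by simp [Instr.exec, hs₆.ireg_two, h17], i, ?_, ?_, ?_, ?_, ?_⟩
  · exact List.nodup_cons.2 ⟨hil, h.nodup⟩
  · exact List.pairwise_cons.2 ⟨fun b hb => h.le i hil b hb, h.sorted⟩
  · intro k hk b hb
    rw [List.mem_cons, not_or] at hk
    rcases List.mem_cons.1 hb with rfl | hb
    · exact hmin k hk.2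
    · exact h.le k hk.2 b hb
  · intro j hj
    change s₆.rarr 5 j = _
    rw [hu₆.rarr 5 rfl, hu₅.rarr 5 rfl, g5 j hj, f8 j hj]
  · exact ⟨ht.leaf, ht.inner, ht.parent⟩

theorem spec_extract (hG : GoodNumbers I t G) (hs : HasInput I t s) (hz : HasReservations I t s)
    (h : IsProcessed I t s []) (h17 : s.ireg 17 = 0) :
    Spec G extract (n * (m * (m * 26 + 31) + m * 8 + (Nat.log 2 n + 1) * 36 + 41) + 1)
      (n * (m * (m * 2))) s
      fun s' => ∃ l : List (Fin n), l.length = n ∧ IsProcessed I t s' l := by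
  refine (Spec.loop n (fun k s' => s'.ireg 17 = k ∧ ∃ l : List (Fin n), l.length = k ∧
    IsProcessed I t s' l) ⟨h17, [], rfl, h⟩ ?_ ?_).conseq (fun _ _ h => h.2) le_rfl le_rfl
  · rintro k hk s' hu ⟨e17, l, rfl, hl⟩
    have hs' := hs.unchanged hu rfl
    refine ⟨by simpa [Test.Holds, e17, hs'.ireg_zero] using hk,
      (spec_extractBody hG hs' (hz.unchanged hu rfl rfl rfl rfl) hl hk).conseq
        (fun s'' _ h => ?_) le_rfl le_rfl⟩
    obtain ⟨h1, i, h2⟩ := h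
    exact ⟨by rw [h1, e17], i :: l, rfl, h2⟩
  · rintro s' hu ⟨h, -⟩
    have hs' := hs.unchanged hu rfl
    simp [Test.Holds, h, hs'.ireg_zero]

/-! ### The whole program -/

theorem isPrincipalUtility_of_isProcessed (ht : IsContract t) {l : List (Fin n)}
    (h : IsProcessed I t s l) (hl : l.length = n) : I.IsPrincipalUtility t (s.rarr 5 0) := by
  rw [h.value 0 (NeZero.pos m)]
  refine I.isPrincipalUtility_value t ht h.nodup (fun i => ?_) h.sorted
  have h1 : l.toFinset.card = Fintype.card (Fin n) := by
    rw [List.toFinset_card_of_nodup h.nodup, hl, Fintype.card_fin]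
  have h2 := Finset.eq_univ_of_card _ h1
  rw [← List.mem_toFinset, h2]
  exact Finset.mem_univ i

theorem inputMemory_prob {i a : ℕ} (hi : i < n) (ha : a < m) :
    (inputMemory I t).rarr 3 (i * m + a) = I.probAt i a := by
  have h1 : (i * m + a) / m = i := by
    rw [mul_comm, Nat.mul_add_div (by omega), Nat.div_eq_of_lt ha, add_zero]
  have h2 : (i * m + a) % m = a := by
    rw [mul_comm, Nat.mul_add_mod, Nat.mod_eq_of_lt ha]
  simp [inputMemory, h1, h2, Setting.probAt, extendZero, hi, ha]

theorem all_inputMemory (hG : GoodNumbers I t G) : (inputMemory I t).All G := by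
  refine ⟨fun a => hG.zero, fun A k => ?_⟩
  simp only [inputMemory]
  split_ifs
  · exact hG.payment _
  · exact hG.zero
  · exact hG.reward _
  · exact hG.zero
  · exact hG.cost _
  · exact hG.zero
  · exact hG.prob _ _
  · exact hG.zero
  · exact hG.zero

theorem spec_principalUtility (ht : IsContract t) (hG : GoodNumbers I t G) :
    Spec G principalUtility (1000 * (n * m ^ 2 + n * Nat.log 2 n + 1)) (1000 * (n * m ^ 2 + 1))
      (inputMemory I t) fun s' => I.IsPrincipalUtility t (s'.rreg 0) := by
  have hm : 0 < m := NeZero.pos m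
  have hg0 := hG.gain 0 hm
  have e1 : extendZero t 0 = t 0 := extendZero_coe t 0
  have e2 : extendZero I.reward 0 = I.reward 0 := extendZero_coe I.reward 0
  have hnm : n * m ≤ n * m ^ 2 := by
    rw [pow_two]
    exact Nat.mul_le_mul_left n (Nat.le_mul_of_pos_left m hm)
  have hn1 : n ≤ n * m := Nat.le_mul_of_pos_right n hm
  refine Spec.seq (R := fun s' => s'.ireg 2 = 1 ∧ s'.rreg 21 = 1 ∧ s'.rreg 0 = I.gain t 0 ∧ s'.ireg 4 = 0 ∧
      s'.ireg 5 = 0 ∧ s'.ireg 6 = 0 ∧ s'.ireg 7 = n ∧ s'.ireg 11 = n ∧ s'.ireg 17 = 0)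
    (T₁ := 15) (A₁ := 1) (T₂ := 1000 * (n * m ^ 2 + n * Nat.log 2 n) + 100)
    (A₂ := 1000 * (n * m ^ 2)) ((Spec.of_wp ?_).conseq (fun _ _ h => h) (by decide) (by decide))
    ?_ (by omega) (by omega)
  · rw [Setting.gain, e1, e2] at hg0
    simp [start, block, wp, Instr.Creates, Instr.exec, Arith.eval, inputMemory, hG.one, hm, hg0,
      Setting.gain, e1, e2]
  rintro s₁ hu₁ ⟨e2, e21, e0, e4, e5, e6, e7, e11, e17⟩
  have hs₁ : HasInput I t s₁ := by
    constructor
    · rw [hu₁.ireg 0 rfl]; rfl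
    · rw [hu₁.ireg 1 rfl]; rfl
    · exact e2
    · rw [hu₁.ireg 3 rfl]; rfl
    · rw [hu₁.rreg 20 rfl]; rfl
    · exact e21
    · rw [hu₁.rarr 0 rfl]; exact fun _ _ => rfl
    · rw [hu₁.rarr 1 rfl]; exact fun _ _ => rfl
    · rw [hu₁.rarr 2 rfl]; exact fun _ _ => rfl
    · rw [hu₁.rarr 3 rfl]; exact fun i hi a ha => inputMemory_prob hi ha
  -- For `n = 0` the `m` steps for the gains would not fit the bound, hence the branch; for `n > 0`
  -- they are covered by `m ≤ n * m`.
  refine (Spec.cond (T := 1000 * (n * m ^ 2 + n * Nat.log 2 n) + 99) (fun hb => ?_)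
    (fun hb => ?_)).conseq (fun _ _ h => h) le_rfl le_rfl
  swap
  · have hn : n = 0 := by simpa [Test.Holds, hs₁.ireg_zero, hs₁.ireg_three] using hb
    refine (Spec.skip ?_).conseq (fun _ _ h => h) (by omega) (by omega)
    rw [e0]
    subst hn
    exact I.isPrincipalUtility_value t ht (l := []) List.nodup_nil (fun i => i.elim0)
      List.Pairwise.nil
  have hn : 0 < n := by simpa [Test.Holds, hs₁.ireg_zero, hs₁.ireg_three] using hb
  have hmn : m ≤ n * m := Nat.le_mul_of_pos_left m hn
  refine Spec.seq (spec_gains hG hs₁ e4)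
    (T₂ := 900 * (n * m ^ 2 + n * Nat.log 2 n) + 90) (A₂ := 900 * (n * m ^ 2)) ?_ (by omega)
    (by omega)
  intro s₂ hu₂ hg
  have hs₂ := hs₁.unchanged hu₂ rfl
  refine Spec.seq (spec_reservations hG hs₂ (fun j hj => (hg j hj).1)
      (by rw [hu₂.ireg 5 rfl, e5]) (by rw [hu₂.ireg 6 rfl, e6]) (by rw [hu₂.ireg 7 rfl, e7]))
    (T₂ := 600 * (n * m ^ 2 + n * Nat.log 2 n) + 80) (A₂ := 600 * (n * m ^ 2)) ?_
    (by nlinarith) (by nlinarith)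
  rintro s₃ hu₃ ⟨hz₃, hl⟩
  have hs₃ := hs₂.unchanged hu₃ rfl
  refine Spec.seq (spec_build hn hs₃ hz₃ hl
      (by rw [hu₃.ireg 11 rfl, hu₂.ireg 11 rfl, e11]))
    (T₂ := 500 * (n * m ^ 2 + n * Nat.log 2 n) + 70) (A₂ := 600 * (n * m ^ 2)) ?_
    (by nlinarith) (by omega)
  intro s₄ hu₄ ht₄
  have hs₄ := hs₃.unchanged hu₄ rfl
  have hz₄ := hz₃.unchanged hu₄ rfl rfl rfl rfl
  refine Spec.seq (spec_extract hG hs₄ hz₄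
      ⟨List.nodup_nil, List.Pairwise.nil, by simp, fun j hj => ?_, ht₄⟩
      (by rw [hu₄.ireg 17 rfl, hu₃.ireg 17 rfl, hu₂.ireg 17 rfl, e17]))
    (T₂ := 1) (A₂ := 0) ?_ (by nlinarith) (by nlinarith)
  · rw [hu₄.rarr 5 rfl, hu₃.rarr 5 rfl, (hg j hj).2, Setting.value]
  rintro s₅ hu₅ ⟨l, hl, hp⟩
  have hs₅ := hs₄.unchanged hu₅ rfl
  refine Spec.of_wp ⟨trivial, ?_⟩
  have : (Instr.exec (.rload 0 5 3) s₅).rreg 0 = s₅.rarr 5 0 := by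
    simp [Instr.exec, hs₅.ireg_three]
  change I.IsPrincipalUtility t _
  rw [this]
  exact isPrincipalUtility_of_isProcessed ht hp hl

end

/-! ### Bit sizes -/

/-- Reducing a fraction only shrinks numerator and denominator, and a number up to `2 ^ e` has at
most `e + 1` bits. -/
theorem hasBitSize_div {a b : ℤ} (hb : b ≠ 0) {e : ℕ} (ha' : a.natAbs ≤ 2 ^ e)
    (hb' : b.natAbs ≤ 2 ^ e) : HasBitSize ((a : ℝ) / b) (2 * e + 2) := by
  refine ⟨Rat.divInt a b, by rw [Rat.divInt_eq_div]; push_cast; rfl, ?_⟩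
  have hsize : ∀ {x : ℕ}, x ≤ 2 ^ e → x.size ≤ e + 1 := fun h =>
    Nat.size_le.2 (h.trans_lt (Nat.pow_lt_pow_right (by omega) (by omega)))
  have h1 : (Rat.divInt a b).num.natAbs ≤ 2 ^ e := by
    rcases eq_or_ne a 0 with rfl | ha
    · simp
    · exact (Nat.le_of_dvd (Int.natAbs_pos.2 ha)
        (Int.natAbs_dvd_natAbs.2 (Rat.num_dvd a hb))).trans ha'
  have h2 : (Rat.divInt a b).den ≤ 2 ^ e := by
    have := Int.natAbs_dvd_natAbs.2 (Rat.den_dvd a b)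
    rw [Int.natAbs_natCast] at this
    exact (Nat.le_of_dvd (Int.natAbs_pos.2 hb) this).trans hb'
  have := hsize h1
  have := hsize h2
  omega

/-- `x` is a fraction with denominator `Q`, and its absolute value is at most `B`. -/
def IsFraction (Q : ℕ) (B : ℝ) (x : ℝ) : Prop := (∃ z : ℤ, x * Q = z) ∧ |x| ≤ B

namespace IsFraction

variable {Q Q' : ℕ} {B B' x y : ℝ}

theorem nonneg (h : IsFraction Q B x) : 0 ≤ B := (abs_nonneg x).trans h.2

theorem mono (h : IsFraction Q B x) (hB : B ≤ B') : IsFraction Q B' x := ⟨h.1, h.2.trans hB⟩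

theorem pow_mono {e e' : ℕ} (h : IsFraction (Q ^ e) B x) (he : e ≤ e') :
    IsFraction (Q ^ e') B x := by
  obtain ⟨⟨z, hz⟩, hB⟩ := h
  obtain ⟨k, rfl⟩ := Nat.exists_eq_add_of_le he
  refine ⟨⟨z * (Q : ℤ) ^ k, ?_⟩, hB⟩
  push_cast at hz ⊢
  rw [pow_add, ← mul_assoc, hz]

theorem zero (hB : 0 ≤ B) : IsFraction Q B 0 := ⟨⟨0, by simp⟩, by simpa using hB⟩

theorem one (hB : 1 ≤ B) : IsFraction Q B 1 := ⟨⟨Q, by simp⟩, by simpa using hB⟩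

theorem neg (h : IsFraction Q B x) : IsFraction Q B (-x) := by
  obtain ⟨⟨z, hz⟩, hB⟩ := h
  exact ⟨⟨-z, by push_cast; rw [neg_mul, hz]⟩, by rwa [abs_neg]⟩

/-- With a fixed common denominator, sums enlarge only the numerator bound. -/
theorem add (h : IsFraction Q B x) (h' : IsFraction Q B' y) : IsFraction Q (B + B') (x + y) := by
  obtain ⟨⟨z, hz⟩, hB⟩ := h
  obtain ⟨⟨z', hz'⟩, hB'⟩ := h'
  exact ⟨⟨z + z', by push_cast; rw [add_mul, hz, hz']⟩, (abs_add_le x y).trans (add_le_add hB hB')⟩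

theorem sub (h : IsFraction Q B x) (h' : IsFraction Q B' y) : IsFraction Q (B + B') (x - y) := by
  rw [sub_eq_add_neg]
  exact h.add h'.neg

theorem mul (h : IsFraction Q B x) (h' : IsFraction Q' B' y) :
    IsFraction (Q * Q') (B * B') (x * y) := by
  have h0 := h.nonneg
  obtain ⟨⟨z, hz⟩, hB⟩ := h
  obtain ⟨⟨z', hz'⟩, hB'⟩ := h'
  refine ⟨⟨z * z', ?_⟩, ?_⟩
  · push_cast
    rw [← hz, ← hz']
    ring
  · rw [abs_mul]
    exact mul_le_mul hB hB' (abs_nonneg y) h0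

theorem sum {ι : Type*} {s : Finset ι} {f : ι → ℝ} (h : ∀ i ∈ s, IsFraction Q B (f i)) :
    IsFraction Q (s.card * B) (∑ i ∈ s, f i) := by
  classical
  induction s using Finset.induction_on with
  | empty => exact zero (by simp)
  | insert i s hi ih =>
    rw [Finset.sum_insert hi, Finset.card_insert_of_notMem hi]
    refine ((h i (by simp)).add (ih fun k hk => h k (by simp [hk]))).mono (le_of_eq ?_)
    push_cast
    ring

theorem extendZero {m : ℕ} {f : Fin m → ℝ} (hB : 0 ≤ B) (h : ∀ j, IsFraction Q B (f j)) (k : ℕ) :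
    IsFraction Q B (extendZero f k) := by
  rw [SeqContract.extendZero]
  split_ifs
  · exact h _
  · exact zero hB

theorem numerator_le {e k : ℕ} (h : IsFraction Q (2 ^ e) x) (hQ : Q ≤ 2 ^ k) :
    ∃ z : ℤ, x * Q = z ∧ z.natAbs ≤ 2 ^ (e + k) := by
  obtain ⟨⟨z, hz⟩, hB⟩ := h
  refine ⟨z, hz, ?_⟩
  have h1 : ((z.natAbs : ℕ) : ℝ) ≤ ((2 ^ (e + k) : ℕ) : ℝ) := by
    rw [Nat.cast_natAbs, Int.cast_abs, ← hz, abs_mul, Nat.abs_cast, pow_add]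
    push_cast
    refine mul_le_mul hB ?_ (Nat.cast_nonneg _) (by positivity)
    exact_mod_cast hQ
  exact_mod_cast h1

theorem hasBitSize {e k : ℕ} (h : IsFraction Q (2 ^ e) x) (h0 : 0 < Q) (hQ : Q ≤ 2 ^ k) :
    HasBitSize x (2 * (e + k) + 2) := by
  obtain ⟨z, hz, hz'⟩ := h.numerator_le hQ
  have : x = (z : ℝ) / ((Q : ℤ) : ℝ) := by
    rw [← hz, Int.cast_natCast, mul_div_assoc, div_self (by positivity), mul_one]
  rw [this]
  refine hasBitSize_div (by omega) hz' ?_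
  rw [Int.natAbs_natCast]
  exact hQ.trans (Nat.pow_le_pow_right (by omega) (by omega))

/-- One factor cancels: `(z / Q²) / (w / Q) = z / (w Q)`, and the numerator bound of `y` controls
the new denominator. -/
theorem hasBitSize_div {e k : ℕ} (h : IsFraction (Q ^ 2) (2 ^ e) x)
    (h' : IsFraction Q (2 ^ e) y) (hy : y ≠ 0) (h0 : 0 < Q) (hQ : Q ≤ 2 ^ k) :
    HasBitSize (x / y) (2 * (e + 2 * k) + 2) := by
  have hQ2 : Q ^ 2 ≤ 2 ^ (2 * k) := by
    rw [mul_comm, pow_mul]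
    exact Nat.pow_le_pow_left hQ 2
  obtain ⟨z, hz, hz'⟩ := h.numerator_le hQ2
  obtain ⟨w, hw, hw'⟩ := h'.numerator_le hQ
  have hQ0 : (Q : ℝ) ≠ 0 := by positivity
  have hw0 : w ≠ 0 := by
    rintro rfl
    rw [Int.cast_zero] at hw
    exact mul_ne_zero hy hQ0 hw
  have : x / y = (z : ℝ) / ((w * Q : ℤ) : ℝ) := by
    push_cast
    rw [← hz, ← hw]
    push_cast
    field_simp
  rw [this]
  refine SeqContract.hasBitSize_div (mul_ne_zero hw0 (by omega)) hz' ?_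
  rw [Int.natAbs_mul, Int.natAbs_natCast]
  calc w.natAbs * Q ≤ 2 ^ (e + k) * 2 ^ k := Nat.mul_le_mul hw' hQ
    _ = 2 ^ (e + 2 * k) := by rw [← pow_add]; congr 1; omega

end IsFraction

theorem HasBitSize.mono {x : ℝ} {B B' : ℕ} (h : HasBitSize x B) (hB : B ≤ B') :
    HasBitSize x B' := by
  obtain ⟨q, hq, h⟩ := h
  exact ⟨q, hq, h.trans hB⟩

theorem HasBitSize.abs_le {x : ℝ} {L : ℕ} (h : HasBitSize x L) : |x| ≤ 2 ^ L := by
  obtain ⟨q, rfl, h⟩ := h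
  have h1 : q.num.natAbs ≤ 2 ^ L :=
    (Nat.size_le.1 (le_rfl : q.num.natAbs.size ≤ _)).le.trans
      (Nat.pow_le_pow_right (by omega) (by omega))
  have h2 : |q| ≤ q.num.natAbs := by
    have h3 : (1 : ℚ) ≤ q.den := Nat.one_le_cast.2 q.pos
    rw [Rat.abs_def, Rat.divInt_eq_div]
    push_cast
    rw [Nat.cast_natAbs, Int.cast_abs]
    exact div_le_self (abs_nonneg _) h3
  calc |(q : ℝ)| = ((|q| : ℚ) : ℝ) := by push_cast; rfl
    _ ≤ ((q.num.natAbs : ℕ) : ℝ) := by exact_mod_cast h2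
    _ ≤ 2 ^ L := by exact_mod_cast h1

/-- A common denominator. -/
theorem exists_common_denominator {ι : Type*} [Fintype ι] {x : ι → ℝ} {L : ℕ}
    (h : ∀ i, HasBitSize (x i) L) :
    ∃ Q : ℕ, 0 < Q ∧ Q ≤ 2 ^ (L * Fintype.card ι) ∧ ∀ i, IsFraction Q (2 ^ L) (x i) := by
  classical
  choose q hq hL using h
  refine ⟨∏ i, (q i).den, Finset.prod_pos fun i _ => (q i).pos, ?_, fun i => ⟨?_, ?_⟩⟩
  · have : ∀ i ∈ Finset.univ, (q i).den ≤ 2 ^ L := fun i _ =>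
      (Nat.size_le.1 (le_rfl : (q i).den.size ≤ _)).le.trans
        (Nat.pow_le_pow_right (by omega) (by have := hL i; omega))
    refine (Finset.prod_le_prod' this).trans (le_of_eq ?_)
    rw [Finset.prod_const, Finset.card_univ, pow_mul]
  · refine ⟨(q i).num * ∏ k ∈ Finset.univ.erase i, ((q k).den : ℤ), ?_⟩
    rw [← Finset.mul_prod_erase Finset.univ _ (Finset.mem_univ i), ← hq i]
    push_cast
    rw [← mul_assoc]
    congr 1
    exact_mod_cast Rat.mul_den_eq_num (q i)
  · exact HasBitSize.abs_le ⟨q i, hq i, hL i⟩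

/-! ### Bit bounds for every number in the computation -/

section

variable {n m : ℕ} [NeZero m] {I : Setting n m} {t : Fin m → ℝ}

/-- With `N = n + m + L + 1` there are at most `N²` input numbers, each with a denominator of at
most `2 ^ L`; their product gives the exponent `N³`. -/
theorem exists_isFraction {L : ℕ} (h : InputBitSize I t L) :
    ∃ Q : ℕ, 0 < Q ∧ Q ≤ 2 ^ ((n + m + L + 1) ^ 3) ∧
      (∀ j, IsFraction Q (2 ^ L) (t j)) ∧ (∀ j, IsFraction Q (2 ^ L) (I.reward j)) ∧
      (∀ i, IsFraction Q (2 ^ L) (I.cost i)) ∧ ∀ i j, IsFraction Q (2 ^ L) (I.prob i j) := by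
  have hx : ∀ i : (Fin m ⊕ Fin m) ⊕ (Fin n ⊕ (Fin n × Fin m)), HasBitSize
      (Sum.elim (Sum.elim t I.reward) (Sum.elim I.cost fun p => I.prob p.1 p.2) i) L := by
    rintro ((j | j) | (i | ⟨i, j⟩))
    · exact (h.1 j).1
    · exact (h.1 j).2
    · exact (h.2 i).1
    · exact (h.2 i).2 j
  obtain ⟨Q, h0, hQ, hf⟩ := exists_common_denominator hx
  refine ⟨Q, h0, hQ.trans (Nat.pow_le_pow_right (by omega) ?_), fun j => hf (.inl (.inl j)),
    fun j => hf (.inl (.inr j)), fun i => hf (.inr (.inl i)), fun i j => hf (.inr (.inr (i, j)))⟩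
  simp only [Fintype.card_sum, Fintype.card_prod, Fintype.card_fin]
  rw [pow_succ']
  refine Nat.mul_le_mul (by omega) ?_
  nlinarith [Nat.zero_le L, Nat.zero_le (n * m), Nat.zero_le (n * L), Nat.zero_le (m * L),
    Nat.zero_le (n * n), Nat.zero_le (m * m)]

/-- The values are fractions with bounded numerator and denominator. -/
theorem isFraction_value {Q : ℕ} {B b : ℝ} (hg : ∀ j, IsFraction Q B (I.gain t j))
    (hp : ∀ i a, IsFraction Q b (I.probAt i a)) (l : List (Fin n)) (j : ℕ) :
    IsFraction (Q ^ (l.length + 1)) B (I.value t l j) := by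
  have hgain : ∀ e j, IsFraction (Q ^ (e + 1)) B (I.gain t j) := fun e j =>
    IsFraction.pow_mono (e := 1) (by simpa using hg j) (by omega)
  induction l generalizing j with
  | nil => exact hgain 0 j
  | cons i l ih =>
    rw [Setting.value]
    split_ifs
    · constructor
      · refine (IsFraction.sum (B := b * B) fun a _ => ?_).1
        rw [List.length_cons, pow_succ']
        exact (hp i a).mul (ih _)
      -- Bounding the terms separately would lose a factor per action; a weighted average with total
      -- weight one keeps the bound `B`.
      · calc |∑ a ∈ Finset.range m, I.probAt i a * I.value t l (I.better t j a)|
            ≤ ∑ a ∈ Finset.range m, |I.probAt i a * I.value t l (I.better t j a)| :=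
              Finset.abs_sum_le_sum_abs _ _
          _ ≤ ∑ a ∈ Finset.range m, I.probAt i a * B := by
              refine Finset.sum_le_sum fun a ha => ?_
              have h0 : 0 ≤ I.probAt i a := by
                have := I.prob_nonneg i ⟨a, Finset.mem_range.1 ha⟩
                rwa [← I.probAt_coe] at this
              rw [abs_mul, abs_of_nonneg h0]
              exact mul_le_mul_of_nonneg_left (ih _).2 h0
          _ = B := by
              rw [← Finset.sum_mul, Finset.sum_range]
              simp [I.prob_sum]
    · exact hgain _ j

/-- Bounds on numerators and denominators of the input. -/
structure InputFractions (I : Setting n m) (t : Fin m → ℝ) (N Q : ℕ) : Prop where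
  -- The highest power of `Q` that occurs is `Q ^ (n + 2)`; this inequality keeps it below `2 ^ N ^
  -- 4`.
  le_exponent : n + 2 ≤ N
  size_le : m ≤ 2 ^ N
  pos : 0 < Q
  le : Q ≤ 2 ^ N ^ 3
  payment : ∀ j, IsFraction Q (2 ^ N) (extendZero t j)
  reward : ∀ j, IsFraction Q (2 ^ N) (extendZero I.reward j)
  gain : ∀ j, IsFraction Q (2 ^ N) (I.gain t j)
  cost : ∀ i, IsFraction Q (2 ^ N) (extendZero I.cost i)
  prob : ∀ i j, IsFraction Q (2 ^ N) (I.probAt i j)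

theorem exists_inputFractions {L : ℕ} (h : InputBitSize I t L) :
    ∃ Q, InputFractions I t (n + m + L + 1) Q := by
  obtain ⟨Q, h0, hQ, ht, hr, hc, hp⟩ := exists_isFraction h
  have hm : 0 < m := NeZero.pos m
  have h1 : (2 : ℝ) ^ L ≤ 2 ^ (n + m + L + 1) := pow_le_pow_right₀ one_le_two (by omega)
  have h2 : (2 : ℝ) ^ L + 2 ^ L ≤ 2 ^ (n + m + L + 1) := by
    rw [← two_mul, ← pow_succ']
    exact pow_le_pow_right₀ one_le_two (by omega)
  refine ⟨Q, by omega, Nat.lt_two_pow_self.le.trans (Nat.pow_le_pow_right (by omega) (by omega)),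
    h0, hQ, fun j => ?_, fun j => ?_, fun j => ?_, fun i => ?_, fun i j => ?_⟩
  · exact (IsFraction.extendZero (by positivity) ht j).mono h1
  · exact (IsFraction.extendZero (by positivity) hr j).mono h1
  · exact ((IsFraction.extendZero (by positivity) hr j).sub
      (IsFraction.extendZero (by positivity) ht j)).mono h2
  · exact (IsFraction.extendZero (by positivity) hc i).mono h1
  · rw [Setting.probAt]
    split_ifs with hi
    · exact (IsFraction.extendZero (by positivity) (hp ⟨i, hi⟩) j).mono h1
    · exact IsFraction.zero (by positivity)

namespace InputFractions

variable {N Q : ℕ}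

theorem two_le (h : InputFractions I t N Q) : (2 : ℝ) ≤ 2 ^ N := by
  have := h.le_exponent
  calc (2 : ℝ) = 2 ^ 1 := (pow_one _).symm
    _ ≤ 2 ^ N := pow_le_pow_right₀ one_le_two (by omega)

/-- The absolute value contributes exponent `4 N` and the denominator `N ^ 4`; the factor `16`
absorbs `2 * (4 * N + N ^ 4) + 2`. -/
theorem hasBitSize (h : InputFractions I t N Q) {e : ℕ} (he : e ≤ n + 2) {B x : ℝ}
    (hx : IsFraction (Q ^ e) B x) (hB : B ≤ (2 ^ N) ^ 4) : HasBitSize x (16 * N ^ 4) := by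
  have h2 := h.le_exponent
  have hQ : Q ^ e ≤ 2 ^ (N ^ 4) := by
    calc Q ^ e ≤ (2 ^ N ^ 3) ^ e := Nat.pow_le_pow_left h.le e
      _ = 2 ^ (N ^ 3 * e) := by rw [pow_mul]
      _ ≤ 2 ^ (N ^ 4) := Nat.pow_le_pow_right (by omega) (by
          rw [pow_succ N 3]
          exact Nat.mul_le_mul_left _ (by omega))
  rw [← pow_mul] at hB
  refine ((hx.mono hB).hasBitSize (pow_pos h.pos e) hQ).mono ?_
  have : N ≤ N ^ 4 := Nat.le_self_pow (by omega) N
  omega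

theorem hasBitSize_one (h : InputFractions I t N Q) {B x : ℝ}
    (hx : IsFraction Q B x) (hB : B ≤ (2 ^ N) ^ 4) : HasBitSize x (16 * N ^ 4) :=
  h.hasBitSize (e := 1) (by omega) (by simpa using hx) hB

theorem hasBitSize_div (h : InputFractions I t N Q) {x y : ℝ}
    (hx : IsFraction (Q ^ 2) ((2 ^ N) ^ 4) x) (hy : IsFraction Q ((2 ^ N) ^ 4) y) (h0 : y ≠ 0) :
    HasBitSize (x / y) (16 * N ^ 4) := by
  rw [← pow_mul] at hx hy
  refine (hx.hasBitSize_div hy h0 h.pos h.le).mono ?_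
  have : N ≤ N ^ 4 := Nat.le_self_pow (by omega) N
  have : N ^ 3 ≤ N ^ 4 := Nat.pow_le_pow_right (by have := h.le_exponent; omega) (by omega)
  have := h.le_exponent
  omega

theorem upperSum (h : InputFractions I t N Q) {Q' : ℕ} {B : ℝ} {f : ℕ → ℝ}
    (hf : ∀ a, IsFraction Q' B (f a)) (j : ℕ) {k : ℕ} (hk : k ≤ m) :
    IsFraction Q' (2 ^ N * B) (I.upperSum t f j k) := by
  refine (IsFraction.sum (B := B) fun a _ => ?_).mono ?_
  · split_ifs
    · exact IsFraction.zero (hf 0).nonneg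
    · exact hf a
  · rw [Finset.card_range]
    refine mul_le_mul_of_nonneg_right ?_ (hf 0).nonneg
    exact_mod_cast hk.trans h.size_le

theorem prob_mul (h : InputFractions I t N Q) {x : ℝ} (hx : IsFraction Q (2 ^ N) x) (i a : ℕ) :
    IsFraction (Q ^ 2) (2 ^ N * 2 ^ N) (I.probAt i a * x) := by
  rw [pow_two]
  exact (h.prob i a).mul hx

theorem upperSum_payment (h : InputFractions I t N Q) (i j : ℕ) {k : ℕ} (hk : k ≤ m) :
    IsFraction (Q ^ 2) ((2 ^ N) ^ 4) (-extendZero I.cost i +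
      I.upperSum t (fun a => I.probAt i a * extendZero t a) j k) := by
  have h1 : IsFraction (Q ^ 2) (2 ^ N) (-extendZero I.cost i) :=
    IsFraction.pow_mono (e := 1) (by simpa using (h.cost i).neg) (by omega)
  refine (h1.add (h.upperSum (fun a => h.prob_mul (h.payment a) i a) j hk)).mono ?_
  have hb := h.two_le
  generalize (2 : ℝ) ^ N = b at hb
  nlinarith [pow_le_pow_right₀ (by linarith : (1 : ℝ) ≤ b) (by omega : 1 ≤ 3),
    pow_nonneg (by linarith : (0 : ℝ) ≤ b) 3]

theorem upperSum_gain (h : InputFractions I t N Q) (i j : ℕ) {k : ℕ} (hk : k ≤ m) :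
    IsFraction (Q ^ 2) ((2 ^ N) ^ 4) (I.upperSum t (fun a => I.probAt i a * I.gain t a) j k) := by
  refine (h.upperSum (fun a => h.prob_mul (h.gain a) i a) j hk).mono ?_
  have hb := h.two_le
  generalize (2 : ℝ) ^ N = b at hb
  nlinarith [pow_nonneg (by linarith : (0 : ℝ) ≤ b) 3]

theorem upperSum_prob (h : InputFractions I t N Q) (i j : ℕ) {k : ℕ} (hk : k ≤ m) :
    IsFraction Q ((2 ^ N) ^ 4) (I.upperSum t (I.probAt i) j k) := by
  refine (h.upperSum (h.prob i) j hk).mono ?_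
  have hb := h.two_le
  generalize (2 : ℝ) ^ N = b at hb
  calc b * b = b ^ 2 := (pow_two b).symm
    _ ≤ b ^ 4 := pow_le_pow_right₀ (by linarith) (by omega)

/-- A list without duplicates has at most `n` actions, so the value needs at most `Q ^ (n + 1)` and
the probability adds one more factor. -/
theorem prob_mul_value (h : InputFractions I t N Q) {l : List (Fin n)} (hl : l.Nodup)
    (i a j : ℕ) : IsFraction (Q ^ (n + 2)) (2 ^ N * 2 ^ N) (I.probAt i a * I.value t l j) := by
  have h1 := (h.prob i a).mul (isFraction_value h.gain (fun i a => h.prob i a) l j)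
  rw [← pow_succ'] at h1
  exact h1.pow_mono (by have := hl.length_le_card; rw [Fintype.card_fin] at this; omega)

end InputFractions

/-- `L` is quantified inside the predicate, so one run with one halting time serves every `L`; for
irrational inputs the predicate is vacuous. -/
theorem goodNumbers (I : Setting n m) (t : Fin m → ℝ) : GoodNumbers I t fun x =>
    ∀ L, InputBitSize I t L → HasBitSize x (16 * (n + m + L + 1) ^ 4) := by
  have key : ∀ x : ℝ, (∀ N Q, InputFractions I t N Q → HasBitSize x (16 * N ^ 4)) →
      ∀ L, InputBitSize I t L → HasBitSize x (16 * (n + m + L + 1) ^ 4) := by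
    intro x hx L hL
    obtain ⟨Q, hQ⟩ := exists_inputFractions hL
    exact hx _ Q hQ
  have h1 : ∀ {N Q}, InputFractions I t N Q → (2 : ℝ) ^ N ≤ (2 ^ N) ^ 4 := fun h =>
    le_self_pow₀ (by linarith [h.two_le]) (by omega)
  have h2 : ∀ {N Q}, InputFractions I t N Q → (2 : ℝ) ^ N * 2 ^ N ≤ (2 ^ N) ^ 4 := fun h => by
    rw [← pow_two]
    exact pow_le_pow_right₀ (by linarith [h.two_le]) (by omega)
  constructor
  · exact key _ fun N Q h => h.hasBitSize_one (IsFraction.zero (by positivity)) (h1 h)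
  · exact key _ fun N Q h => h.hasBitSize_one (IsFraction.one (by linarith [h.two_le])) (h1 h)
  · exact fun j => key _ fun N Q h => h.hasBitSize_one (by simpa using h.payment j) (h1 h)
  · exact fun j => key _ fun N Q h => h.hasBitSize_one (by simpa using h.reward j) (h1 h)
  · exact fun i => key _ fun N Q h => h.hasBitSize_one (by simpa using h.cost i) (h1 h)
  · exact fun i j => key _ fun N Q h => h.hasBitSize_one (by simpa using h.prob i j) (h1 h)
  · exact fun j _ => key _ fun N Q h => h.hasBitSize_one (h.gain j) (h1 h)
  · exact fun i _ => key _ fun N Q h => h.hasBitSize_one (h.cost i).neg (h1 h)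
  · refine fun i _ => key _ fun N Q h => h.hasBitSize_one ((h.cost i).neg.sub
      (IsFraction.one le_rfl)) (le_trans ?_ (h2 h))
    nlinarith [h.two_le]
  · exact fun i _ a _ => key _ fun N Q h =>
      h.hasBitSize (by omega) (h.prob_mul (h.payment a) i a) (h2 h)
  · exact fun i _ a _ => key _ fun N Q h =>
      h.hasBitSize (by omega) (h.prob_mul (h.gain a) i a) (h2 h)
  · exact fun i _ j _ k hk => key _ fun N Q h =>
      h.hasBitSize (by omega) (h.upperSum_payment i j hk) le_rfl
  · exact fun i _ j _ k hk => key _ fun N Q h =>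
      h.hasBitSize (by omega) (h.upperSum_gain i j hk) le_rfl
  · exact fun i _ j _ k hk => key _ fun N Q h =>
      h.hasBitSize_one (h.upperSum_prob i j hk) le_rfl
  · exact fun i _ j _ h0 => ⟨key _ fun N Q h => h.hasBitSize_div (h.upperSum_payment i j le_rfl)
        (h.upperSum_prob i j le_rfl) h0.ne',
      key _ fun N Q h => h.hasBitSize_div (h.upperSum_gain i j le_rfl)
        (h.upperSum_prob i j le_rfl) h0.ne'⟩
  · exact fun l hl i _ a _ j _ => key _ fun N Q h =>
      h.hasBitSize le_rfl (h.prob_mul_value hl i a j) (h2 h)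
  · refine fun l hl i _ j _ k hk => key _ fun N Q h =>
      h.hasBitSize le_rfl (IsFraction.sum fun a _ => h.prob_mul_value hl i a _) ?_
    rw [Finset.card_range]
    have hkN : (k : ℝ) ≤ 2 ^ N := by exact_mod_cast hk.trans h.size_le
    have hb := h.two_le
    generalize (2 : ℝ) ^ N = b at hb hkN
    calc k * (b * b) ≤ b * (b * b) := mul_le_mul_of_nonneg_right hkN (by nlinarith)
      _ = b ^ 3 := by ring
      _ ≤ b ^ 4 := pow_le_pow_right₀ (by linarith) (by omega)

end

end SeqContract

theorem mainTheorem8 :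
    -- optimal strategies of the perturbed contract, among them a non-adaptive one
    (∀ (n m : ℕ) [NeZero m] (I : SeqContract.Setting n m) (t : Fin m → ℝ),
      SeqContract.IsContract t →
      ∃ ε₀ : ℝ, 0 < ε₀ ∧ ∀ ε : ℝ, 0 < ε → ε < ε₀ →
        SeqContract.IsContract (I.perturb t ε) ∧
        (∀ π : SeqContract.Strategy n m, I.IsOptimal (I.perturb t ε) π → I.IsBestResponse t π) ∧
        ∃ (σ : Equiv.Perm (Fin n)) (ρ : Equiv.Perm (Fin m)) (τ : Fin n → Fin m),
          I.IsOptimal (I.perturb t ε) (SeqContract.Strategy.nonAdaptive σ ρ τ)) ∧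
    -- one program computes the principal's utility for all instances and contracts
    ∃ (P : SeqContract.Prog) (C d : ℕ),
      ∀ (n m : ℕ) [NeZero m] (I : SeqContract.Setting n m) (t : Fin m → ℝ),
        SeqContract.IsContract t →
        ∃ T : ℕ,
          (P.run (SeqContract.inputMemory I t) T).todo = [] ∧
          I.IsPrincipalUtility t ((P.run (SeqContract.inputMemory I t) T).mem.rreg 0) ∧
          T ≤ C * (n * m ^ 2 + n * Nat.log 2 n + 1) ∧
          P.arithCount (SeqContract.inputMemory I t) T ≤ C * (n * m ^ 2 + 1) ∧
          ∀ L : ℕ, SeqContract.InputBitSize I t L →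
            ∀ k : ℕ, SeqContract.MemoryBitSize (P.run (SeqContract.inputMemory I t) k).mem
              (C * (n + m + L + 1) ^ d) := by
  refine ⟨fun n m _ I t ht => I.exists_perturb_pos ht,
    SeqContract.Prog.principalUtility, 1000, 4, fun n m _ I t ht => ?_⟩
  have hG := SeqContract.goodNumbers I t
  obtain ⟨T, hT, h1, h2, h3, h4⟩ :=
    (SeqContract.spec_principalUtility ht hG).run (SeqContract.all_inputMemory hG)
  refine ⟨T, h1, h2, hT, h3, fun L hL k => ?_⟩
  have hle : 16 * (n + m + L + 1) ^ 4 ≤ 1000 * (n + m + L + 1) ^ 4 :=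
    Nat.mul_le_mul_right _ (by omega)
  exact ⟨fun a => ((h4 k).1 a L hL).mono hle, fun A i => ((h4 k).2 A i L hL).mono hle⟩
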